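/- Call a function $\psi:[0,2\pi]\to\mathbb{R}$ a rational step function with endpoints $(a_1,b_1),\dots,(a_t,b_t)$, where $a_1<\dots<a_t$ and $b_1,\dots,b_t$ are rational numbers, if $\psi(x)=b_i$ for $x\in[a_i,a_{i+1})\cap[0,2\pi]$ $(1\le i\le t-1)$ and $\psi(x)=0$ at all other $x\in[0,2\pi]$. A Lebesgue integrable function $f:[0,2\pi]\to\mathbb{R}$ is called $L^1$-computable if there is a Turing machine that, on every input $m\in\mathbb{N}$, outputs the endpoints of a rational step function $\psi_m$ with $\int_0^{2\pi}|\psi_m(x)-f(x)|\,dx<2^{-m}$. There exists an $L^1$-computable function $f:[0,2\pi]\to\mathbb{R}$ whose Fourier series diverges almost everywhere. That is, with $$a_n=\frac1\pi\int_0^{2\pi}f(t)\cos nt\,dt,\qquad b_n=\frac1\pi\int_0^{2\pi}f(t)\sin nt\,dt\qquad(n\ge 0),$$ $$S_l(f,x)=\frac{a_0}{2}+\sum_{n=1}^{l}(a_n\cos nx+b_n\sin nx),$$ for almost every $x\in[0,2\pi]$ the sequence $(S_l(f,x))_{l\ge 0}$ does not converge to a real number. -/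

import Mathlib

open MeasureTheory Filter Topology

open scoped ENNReal

noncomputable section

namespace ComputableFourier

/-- Lebesgue measure on the interval `[0, 2π]`. -/
def circleMeasure : Measure ℝ := volume.restrict (Set.Icc 0 (2 * Real.pi))

/-- The step function with endpoints `(a₁, b₁), …, (aₜ, bₜ)`: it takes the value `bᵢ` on
`[aᵢ, aᵢ₊₁)` for `1 ≤ i ≤ t - 1`, and it is `0` outside `[a₁, aₜ)`. (The endpoints are assumed
to be increasing in `IsComputableLp` below.) -/
def stepFunction : List (ℚ × ℚ) → ℝ → ℝ
  | p :: q :: l => fun x =>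
      Set.indicator (Set.Ico (p.1 : ℝ) (q.1 : ℝ)) (fun _ => (p.2 : ℝ)) x
        + stepFunction (q :: l) x
  | _ => fun _ => 0

/-- A pair of integers `(n, d)`, `d ≥ 0`, is a name of the rational number `n / (d + 1)`. -/
def decodeRat (c : ℤ × ℕ) : ℚ := (c.1 : ℚ) / ((c.2 : ℚ) + 1)

/-- A finite list of pairs of names of rationals is a name of a list `(a₁, b₁), …, (aₜ, bₜ)` of
pairs of rationals. -/
def decodeEndpoints (s : List ((ℤ × ℕ) × (ℤ × ℕ))) : List (ℚ × ℚ) :=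
  s.map fun c => (decodeRat c.1, decodeRat c.2)

/-- `f`, a function on `[0, 2π]` (only its values there matter, and only up to null sets), belongs
to `Lᵖ` and is `Lᵖ`-computable: some computable function maps every `m` to (a name of) the
endpoints of a rational step function at `p`-norm distance less than `2⁻ᵐ` from `f`. -/
def IsComputableLp (p : ℕ+) (f : ℝ → ℝ) : Prop :=
  MemLp f ((p : ℕ) : ℝ≥0∞) circleMeasure ∧
    ∃ s : ℕ → List ((ℤ × ℕ) × (ℤ × ℕ)), Computable s ∧
      ∀ m : ℕ,
        ((decodeEndpoints (s m)).map Prod.fst).Pairwise (· < ·) ∧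
        eLpNorm (fun x => stepFunction (decodeEndpoints (s m)) x - f x)
          ((p : ℕ) : ℝ≥0∞) circleMeasure < ENNReal.ofReal ((2 : ℝ) ^ (-(m : ℤ)))

/-- The Fourier coefficient `aₙ = (1/π) ∫₀^{2π} f(t) cos(nt) dt`. -/
def fourierCos (f : ℝ → ℝ) (n : ℕ) : ℝ :=
  (1 / Real.pi) * ∫ t in (0 : ℝ)..(2 * Real.pi), f t * Real.cos (n * t)

/-- The Fourier coefficient `bₙ = (1/π) ∫₀^{2π} f(t) sin(nt) dt`. -/
def fourierSin (f : ℝ → ℝ) (n : ℕ) : ℝ :=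
  (1 / Real.pi) * ∫ t in (0 : ℝ)..(2 * Real.pi), f t * Real.sin (n * t)

/-- The `l`-th partial sum `S_l(f, x) = a₀/2 + ∑_{n=1}^{l} (aₙ cos nx + bₙ sin nx)` of the Fourier
series of `f`. -/
def fourierPartialSum (f : ℝ → ℝ) (l : ℕ) (x : ℝ) : ℝ :=
  fourierCos f 0 / 2 +
    ∑ n ∈ Finset.Icc 1 l,
      (fourierCos f n * Real.cos (n * x) + fourierSin f n * Real.sin (n * x))

/-- The Fourier series of `f` diverges at `x`: its partial sums have no limit in `ℝ`. -/
def FourierSeriesDivergesAt (f : ℝ → ℝ) (x : ℝ) : Prop :=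
  ¬ ∃ y : ℝ, Tendsto (fun l : ℕ => fourierPartialSum f l x) atTop (𝓝 y)

end ComputableFourier

end

/-! This is a Kolmogorov-type construction made effective. Write b = `blockBase Q`, n = `blockSize
Q` = 2^(Q^3), β = `blockScale Q` = Qb. A block has spikes i = 0, …, n of integral 1/β near the nodes
4πi/b, each far narrower than the one before. For x between nodes j and j + 1, consider the partial
sum of order m with 2m + 1 = `freq Q j`. The spikes i ≤ j are wide on the scale of m, so integration
by parts bounds the mean of D_m(x - t) over each of them by 1 (`abs_spikeMean_le_one`). The spikes i
> j are so narrow that they act as point masses (`abs_spikeMean_sub_dirichlet_le`). Since b divides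
2m + 1, the numerator of D_m(x - node) is the same for all of these nodes (`dirichlet_sub_node`):
there is no cancellation, and the sum is at least |sin((2m + 1)x/2)| times b/(4π) times a harmonic
number of size about Q^3. Off a set of measure O(1/Q) the sine is at least 1/Q, so the block
contributes at least a multiple of Q (`le_abs_blockPart`).

A block has integral at most 1/Q, and the parameters grow so fast that the sum of the blocks
converges in L¹. In a partial sum chosen for block k, the later blocks contribute little because
|D_m| ≤ m + 1/2 and their mass is tiny (`abs_tsum_blockPart_le`). The earlier blocks are controlled
by the estimate for wide spikes. By Borel–Cantelli almost every x is regular for all but finitely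
many blocks, and the remaining ones have bounded partial sums at irrational x because spikes have
rational endpoints. So the partial sums are unbounded (`fourierSeriesDivergesAt_blockSum`).

For computability, the nodes are replaced by rational approximations obtained from Wallis' product.
A finite sum of blocks is then exactly a rational step function with primitive recursive data
(`primrec_gridEndpoints`, `stepFunction_gridEndpoints`), and the L¹ tail is explicitly bounded
(`lintegral_sub_blockSum_le`). -/

namespace ComputableFourier

/-! ### Closure properties of primitive recursive functions -/

section Primrec

variable {α : Type*} [Primcodable α]

theorem primrec_pow : Primrec₂ ((· ^ ·) : ℕ → ℕ → ℕ) :=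
  Primrec₂.unpaired'.1 Nat.Primrec.pow

theorem primrec_sum_range {f : α → ℕ → ℕ} {g : α → ℕ} (hf : Primrec₂ f) (hg : Primrec g) :
    Primrec fun a => ∑ i ∈ Finset.range (g a), f a i := by
  refine (Primrec.nat_rec' (h := fun a p => p.2 + f a p.1) hg (Primrec.const 0) ?_).of_eq ?_
  · exact Primrec.nat_add.comp (Primrec.snd.comp Primrec.snd)
      (hf.comp Primrec.fst (Primrec.fst.comp Primrec.snd))
  · intro a
    induction g a with
    | zero => simp
    | succ n ih => rw [Finset.sum_range_succ, ← ih]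

theorem primrec_prod_range {f : α → ℕ → ℕ} {g : α → ℕ} (hf : Primrec₂ f) (hg : Primrec g) :
    Primrec fun a => ∏ i ∈ Finset.range (g a), f a i := by
  refine (Primrec.nat_rec' (h := fun a p => p.2 * f a p.1) hg (Primrec.const 1) ?_).of_eq ?_
  · exact Primrec.nat_mul.comp (Primrec.snd.comp Primrec.snd)
      (hf.comp Primrec.fst (Primrec.fst.comp Primrec.snd))
  · intro a
    induction g a with
    | zero => simp
    | succ n ih => rw [Finset.prod_range_succ, ← ih]

theorem primrec_int_natCast : Primrec (fun n : ℕ => (n : ℤ)) := by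
  refine Primrec.encode_iff.1 ?_
  refine (Primrec.nat_mul.comp (Primrec.const 2) Primrec.id).of_eq fun n => ?_
  rfl

end Primrec

/-! ### Integer approximations to multiples of `π` -/

def wallisNum (k : ℕ) : ℕ := ∏ i ∈ Finset.range k, (2 * i + 2) * (2 * i + 2)

def wallisDen (k : ℕ) : ℕ := ∏ i ∈ Finset.range k, (2 * i + 1) * (2 * i + 3)

theorem wallisDen_pos (k : ℕ) : 0 < wallisDen k :=
  Finset.prod_pos fun i _ => by positivity

theorem wallis_eq (k : ℕ) : Real.Wallis.W k = (wallisNum k : ℝ) / wallisDen k := by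
  rw [Real.Wallis.W, wallisNum, wallisDen, Nat.cast_prod, Nat.cast_prod, ← Finset.prod_div_distrib]
  refine Finset.prod_congr rfl fun i _ => ?_
  push_cast
  rw [div_mul_div_comm]

/-- An integer approximation to `4πk`. -/
def piApprox (k : ℕ) : ℕ := 8 * k * wallisNum (16 * k) / wallisDen (16 * k)

theorem piApprox_le (k : ℕ) : (piApprox k : ℝ) ≤ 4 * Real.pi * k := by
  have h1 : (piApprox k : ℝ) ≤ ((8 * k * wallisNum (16 * k) : ℕ) : ℝ) / wallisDen (16 * k) :=
    Nat.cast_div_le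
  have h2 := Real.Wallis.W_le (16 * k)
  rw [wallis_eq] at h2
  push_cast at h1
  rw [mul_div_assoc] at h1
  have h3 : (0 : ℝ) ≤ 8 * k := by positivity
  nlinarith [mul_le_mul_of_nonneg_left h2 h3]

theorem lt_piApprox (k : ℕ) : 4 * Real.pi * k - 2 < piApprox k := by
  have h1 : ((8 * k * wallisNum (16 * k) : ℕ) : ℝ) / wallisDen (16 * k) < piApprox k + 1 := by
    rw [div_lt_iff₀ (by exact_mod_cast wallisDen_pos _)]
    have := Nat.lt_mul_div_succ (8 * k * wallisNum (16 * k)) (wallisDen_pos (16 * k))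
    rw [mul_comm (wallisDen _)] at this
    rw [piApprox]
    exact_mod_cast this
  have h2 := Real.Wallis.le_W (16 * k)
  rw [wallis_eq] at h2
  push_cast at h1 h2
  rw [mul_div_assoc] at h1
  have h3 : (0 : ℝ) ≤ 8 * k := by positivity
  have h4 := mul_le_mul_of_nonneg_left h2 h3
  -- With 16k Wallis factors the relative error is at most 1/(32k + 2), so the absolute error in 4πk
  -- is below π/8 < 1; rounding down costs less than 1 more.
  have h5 : 4 * Real.pi * k - 1 ≤
      8 * k * ((2 * (16 * k) + 1) / (2 * (16 * k) + 2) * (Real.pi / 2)) := by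
    have hk : (0 : ℝ) < 2 * (16 * k) + 2 := by positivity
    rw [div_mul_eq_mul_div, ← mul_div_assoc, le_div_iff₀ hk]
    have : (0 : ℝ) ≤ k := by positivity
    nlinarith [Real.pi_pos, Real.pi_lt_four, mul_nonneg this this]
  linarith

/-! ### The parameters of the construction -/

/-- There are `blockSize Q + 1` spikes in a block with parameter `Q`. -/
def blockSize (Q : ℕ) : ℕ := 2 ^ Q ^ 3

/-- The spikes in a block are close to the multiples of `4π / blockBase Q`. -/
def blockBase (Q : ℕ) : ℕ := 2 * blockSize Q + 1

/-- Every spike in a block has integral `1 / blockScale Q`. -/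
def blockScale (Q : ℕ) : ℕ := Q * blockBase Q

/-- The `i`-th spike in a block has width `1 / spikeDen Q i`. -/
def spikeDen (Q i : ℕ) : ℕ := blockScale Q ^ (12 * 3 ^ i)

/-- Height times width is `1 / blockScale Q`. The subtraction does not truncate, as the exponent is
at least 12. -/
def spikeHeight (Q i : ℕ) : ℕ := blockScale Q ^ (12 * 3 ^ i - 1)

/-- The left endpoint of the `i`-th spike is `spikePos Q i / spikeDen Q i`. -/
def spikePos (Q i : ℕ) : ℕ := piApprox (spikeDen Q i * i) / blockBase Q

/-- The odd number `2m + 1`, where `m` is the order of the partial sum used between the spikes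
`i` and `i + 1`. -/
def freq (Q i : ℕ) : ℕ := blockBase Q * blockScale Q ^ (12 * 3 ^ i + 5)

/-- The parameter of the `k`-th block. -/
def param : ℕ → ℕ
  -- Oddness is inherited by all parameters and makes every `freq` odd; being at least 40 absorbs
  -- the constant in `mul_spikeDen_le`.
  | 0 => 41
  -- The exponent exceeds those needed to dominate every `freq` and every scaled spike denominator
  -- of block k.
  | k + 1 => blockScale (param k) ^ (12 * 3 ^ blockSize (param k) + 7)

/-! ### Primitive recursiveness of the parameters -/

theorem primrec_wallisNum : Primrec wallisNum := by
  have h : Primrec (fun p : ℕ × ℕ => 2 * p.2 + 2) :=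
    Primrec.nat_add.comp (Primrec.nat_mul.comp (Primrec.const 2) Primrec.snd) (Primrec.const 2)
  exact primrec_prod_range (f := fun _ i => (2 * i + 2) * (2 * i + 2))
    (Primrec.nat_mul.comp h h) Primrec.id

theorem primrec_wallisDen : Primrec wallisDen := by
  have h (c : ℕ) : Primrec (fun p : ℕ × ℕ => 2 * p.2 + c) :=
    Primrec.nat_add.comp (Primrec.nat_mul.comp (Primrec.const 2) Primrec.snd) (Primrec.const c)
  exact primrec_prod_range (f := fun _ i => (2 * i + 1) * (2 * i + 3))
    (Primrec.nat_mul.comp (h 1) (h 3)) Primrec.id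

theorem primrec_piApprox : Primrec piApprox := by
  have h : Primrec (fun k : ℕ => 16 * k) := Primrec.nat_mul.comp (Primrec.const 16) Primrec.id
  exact Primrec.nat_div.comp (Primrec.nat_mul.comp
    (Primrec.nat_mul.comp (Primrec.const 8) Primrec.id) (primrec_wallisNum.comp h))
    (primrec_wallisDen.comp h)

theorem primrec_blockSize : Primrec blockSize :=
  primrec_pow.comp (Primrec.const 2) (primrec_pow.comp Primrec.id (Primrec.const 3))

theorem primrec_blockBase : Primrec blockBase :=
  Primrec.succ.comp (Primrec.nat_mul.comp (Primrec.const 2) primrec_blockSize)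

theorem primrec_blockScale : Primrec blockScale :=
  Primrec.nat_mul.comp Primrec.id primrec_blockBase

theorem primrec_exponent : Primrec (fun i : ℕ => 12 * 3 ^ i) :=
  Primrec.nat_mul.comp (Primrec.const 12) (primrec_pow.comp (Primrec.const 3) Primrec.id)

theorem primrec_spikeDen : Primrec₂ spikeDen :=
  primrec_pow.comp (primrec_blockScale.comp Primrec.fst) (primrec_exponent.comp Primrec.snd)

theorem primrec_spikeHeight : Primrec₂ spikeHeight :=
  primrec_pow.comp (primrec_blockScale.comp Primrec.fst)
    (Primrec.nat_sub.comp (primrec_exponent.comp Primrec.snd) (Primrec.const 1))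

theorem primrec_spikePos : Primrec₂ spikePos :=
  Primrec.nat_div.comp (primrec_piApprox.comp (Primrec.nat_mul.comp primrec_spikeDen Primrec.snd))
    (primrec_blockBase.comp Primrec.fst)

theorem primrec_param : Primrec param := by
  refine (Primrec.nat_rec₁ (f := fun _ q => blockScale q ^ (12 * 3 ^ blockSize q + 7)) 41
    ?_).of_eq fun k => ?_
  · exact primrec_pow.comp (primrec_blockScale.comp Primrec.snd)
      (Primrec.nat_add.comp (primrec_exponent.comp (primrec_blockSize.comp Primrec.snd))
        (Primrec.const 7))
  · induction k with
    | zero => rfl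
    | succ k ih => rw [param, ← ih]

/-! ### The approximating step functions -/

/-- A common denominator of the endpoints of the spikes in the first `K` blocks. -/
def gridDen (K : ℕ) : ℕ :=
  ∏ k ∈ Finset.range K, spikeDen (param k) (blockSize (param k))

/-- The value at `i / gridDen K` of the sum of the first `K` blocks. -/
def gridValue (K i : ℕ) : ℕ :=
  ∑ k ∈ Finset.range K, ∑ j ∈ Finset.range (blockSize (param k) + 1),
    if spikePos (param k) j * gridDen K ≤ i * spikeDen (param k) j ∧
      i * spikeDen (param k) j < (spikePos (param k) j + 1) * gridDen K
    then spikeHeight (param k) j else 0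

/-- The endpoints of the sum of the first `K` blocks. -/
def gridEndpoints (K : ℕ) : List ((ℤ × ℕ) × (ℤ × ℕ)) :=
  -- The grid reaches 7 > 2π. Denominators are stored minus one because `decodeRat` adds one.
  (List.range (7 * gridDen K + 1)).map fun i : ℕ => (((i : ℤ), gridDen K - 1), ((gridValue K i : ℤ), 0))

theorem primrec_gridDen : Primrec gridDen :=
  primrec_prod_range (f := fun _ k => spikeDen (param k) (blockSize (param k)))
    (primrec_spikeDen.comp (primrec_param.comp Primrec.snd)
      (primrec_blockSize.comp (primrec_param.comp Primrec.snd))) Primrec.id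

theorem primrec_gridValue : Primrec₂ gridValue := by
  refine primrec_sum_range (α := ℕ × ℕ) (f := fun p k =>
    ∑ j ∈ Finset.range (blockSize (param k) + 1),
      if spikePos (param k) j * gridDen p.1 ≤ p.2 * spikeDen (param k) j ∧
        p.2 * spikeDen (param k) j < (spikePos (param k) j + 1) * gridDen p.1
      then spikeHeight (param k) j else 0) ?_ Primrec.fst
  refine primrec_sum_range (α := (ℕ × ℕ) × ℕ) (f := fun p j =>
      if spikePos (param p.2) j * gridDen p.1.1 ≤ p.1.2 * spikeDen (param p.2) j ∧
        p.1.2 * spikeDen (param p.2) j < (spikePos (param p.2) j + 1) * gridDen p.1.1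
      then spikeHeight (param p.2) j else 0) ?_
      (Primrec.succ.comp (primrec_blockSize.comp (primrec_param.comp Primrec.snd)))
  have hQ : Primrec (fun p : ((ℕ × ℕ) × ℕ) × ℕ => param p.1.2) :=
    primrec_param.comp (Primrec.snd.comp Primrec.fst)
  have hN : Primrec (fun p : ((ℕ × ℕ) × ℕ) × ℕ => gridDen p.1.1.1) :=
    primrec_gridDen.comp (Primrec.fst.comp (Primrec.fst.comp Primrec.fst))
  have hi : Primrec (fun p : ((ℕ × ℕ) × ℕ) × ℕ => p.1.1.2 * spikeDen (param p.1.2) p.2) :=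
    Primrec.nat_mul.comp (Primrec.snd.comp (Primrec.fst.comp Primrec.fst))
      (primrec_spikeDen.comp hQ Primrec.snd)
  have hc : Primrec (fun p : ((ℕ × ℕ) × ℕ) × ℕ => spikePos (param p.1.2) p.2) :=
    primrec_spikePos.comp hQ Primrec.snd
  exact Primrec.ite
    ((Primrec.nat_le.comp (Primrec.nat_mul.comp hc hN) hi).and
      (Primrec.nat_lt.comp hi (Primrec.nat_mul.comp (Primrec.succ.comp hc) hN)))
    (primrec_spikeHeight.comp hQ Primrec.snd) (Primrec.const 0)

theorem primrec_gridEndpoints : Primrec gridEndpoints := by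
  have h1 : Primrec (fun K => List.range (7 * gridDen K + 1)) :=
    Primrec.list_range.comp (Primrec.succ.comp
      (Primrec.nat_mul.comp (Primrec.const 7) primrec_gridDen))
  have h2 : Primrec (fun p : ℕ × ℕ => ((p.2 : ℤ), gridDen p.1 - 1)) :=
    (primrec_int_natCast.comp Primrec.snd).pair
      (Primrec.pred.comp (primrec_gridDen.comp Primrec.fst))
  have h3 : Primrec (fun p : ℕ × ℕ => ((gridValue p.1 p.2 : ℤ), 0)) :=
    (primrec_int_natCast.comp primrec_gridValue).pair (Primrec.const 0)
  exact Primrec.list_map h1 (Primrec.pair h2 h3)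

theorem blockSize_pos (Q : ℕ) : 0 < blockSize Q := by unfold blockSize; positivity

theorem blockBase_pos (Q : ℕ) : 0 < blockBase Q := Nat.succ_pos _

theorem blockScale_pos {Q : ℕ} (hQ : 0 < Q) : 0 < blockScale Q :=
  Nat.mul_pos hQ (blockBase_pos Q)

theorem spikeDen_pos {Q : ℕ} (hQ : 0 < Q) (i : ℕ) : 0 < spikeDen Q i :=
  Nat.pow_pos (blockScale_pos hQ)

theorem param_pos (k : ℕ) : 0 < param k := by
  induction k with
  | zero => simp [param]
  | succ k ih => exact Nat.pow_pos (blockScale_pos ih)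

theorem gridDen_pos (K : ℕ) : 0 < gridDen K :=
  Finset.prod_pos fun k _ => spikeDen_pos (param_pos k) _

/-! ### Finite sums of blocks as step functions on a grid -/

/-- The support of the `i`-th spike. -/
def spikeSet (Q i : ℕ) : Set ℝ :=
  Set.Ico ((spikePos Q i : ℝ) / spikeDen Q i) (((spikePos Q i : ℝ) + 1) / spikeDen Q i)

noncomputable def spike (Q i : ℕ) : ℝ → ℝ :=
  (spikeSet Q i).indicator fun _ => (spikeHeight Q i : ℝ)

noncomputable def block (Q : ℕ) (x : ℝ) : ℝ := ∑ i ∈ Finset.range (blockSize Q + 1), spike Q i x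

/-- The arbitrary starting index `s` is what lets the induction on the length pass to the tail of
the list. -/
theorem stepFunction_range' (N : ℕ) (v : ℕ → ℕ) (l s : ℕ) (x : ℝ) :
    stepFunction ((List.range' s (l + 1)).map fun i : ℕ => ((i : ℚ) / N, (v i : ℚ))) x =
      ∑ i ∈ Finset.range l, (Set.Ico (((s + i : ℕ) : ℝ) / N) (((s + i + 1 : ℕ) : ℝ) / N)).indicator
        (fun _ => (v (s + i) : ℝ)) x := by
  induction l generalizing s with
  | zero => simp [stepFunction]
  | succ l ih =>
    have h := ih (s + 1)
    rw [List.range'_succ, List.map_cons] at h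
    rw [List.range'_succ, List.range'_succ, List.map_cons, List.map_cons, stepFunction]
    beta_reduce
    rw [h, Finset.sum_range_succ', add_comm]
    congr 1
    · refine Finset.sum_congr rfl fun i _ => ?_
      rw [show s + 1 + i = s + (i + 1) by ring]
    · simp

theorem mem_grid_cell_iff {N : ℕ} (hN : 0 < N) {x : ℝ} (hx : 0 ≤ x) (i : ℕ) :
    x ∈ Set.Ico ((i : ℝ) / N) (((i + 1 : ℕ) : ℝ) / N) ↔ i = ⌊x * N⌋₊ := by
  have hN' : (0 : ℝ) < N := by exact_mod_cast hN
  rw [Set.mem_Ico, div_le_iff₀ hN', lt_div_iff₀ hN', eq_comm, Nat.floor_eq_iff (by positivity)]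
  push_cast
  rfl

theorem stepFunction_range {N : ℕ} (hN : 0 < N) (v : ℕ → ℕ) (l : ℕ) {x : ℝ} (hx : 0 ≤ x)
    (hxl : x * N < l) :
    stepFunction ((List.range (l + 1)).map fun i : ℕ => ((i : ℚ) / N, (v i : ℚ))) x =
      v ⌊x * N⌋₊ := by
  rw [List.range_eq_range', stepFunction_range', Finset.sum_eq_single ⌊x * N⌋₊]
  · simp only [zero_add]
    rw [Set.indicator_of_mem ((mem_grid_cell_iff hN hx _).2 rfl)]
  · intro i _ hi
    simp only [zero_add]
    exact Set.indicator_of_notMem (fun h => hi ((mem_grid_cell_iff hN hx _).1 h)) _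
  · intro h
    refine absurd (Finset.mem_range.2 ?_) h
    exact (Nat.floor_lt (by positivity)).2 hxl

theorem decodeEndpoints_gridEndpoints (K : ℕ) :
    decodeEndpoints (gridEndpoints K) = (List.range (7 * gridDen K + 1)).map
      fun i : ℕ => ((i : ℚ) / gridDen K, (gridValue K i : ℚ)) := by
  rw [decodeEndpoints, gridEndpoints, List.map_map]
  refine List.map_congr_left fun i _ => ?_
  have : ((gridDen K - 1 : ℕ) : ℚ) + 1 = gridDen K := by
    exact_mod_cast Nat.sub_add_cancel (gridDen_pos K)
  simp [decodeRat, this]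

theorem pairwise_gridEndpoints (K : ℕ) :
    ((decodeEndpoints (gridEndpoints K)).map Prod.fst).Pairwise (· < ·) := by
  rw [decodeEndpoints_gridEndpoints, List.map_map, List.pairwise_map]
  refine List.pairwise_lt_range.imp fun {a b} h => ?_
  have hN : (0 : ℚ) < gridDen K := by exact_mod_cast gridDen_pos K
  exact div_lt_div_of_pos_right (by exact_mod_cast h) hN

theorem spikeDen_dvd_gridDen {K k i : ℕ} (hk : k < K) (hi : i ≤ blockSize (param k)) :
    spikeDen (param k) i ∣ gridDen K := by
  refine dvd_trans ?_ (Finset.dvd_prod_of_mem _ (Finset.mem_range.2 hk))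
  exact pow_dvd_pow _ (Nat.mul_le_mul_left _ (Nat.pow_le_pow_right (by norm_num) hi))

/-- All spike endpoints are multiples of `1 / gridDen K`, so comparing x with an endpoint is the
same as comparing the left end of its grid cell, which is a test on natural numbers. -/
theorem gridValue_eq (K : ℕ) {x : ℝ} (hx : 0 ≤ x) :
    (gridValue K ⌊x * gridDen K⌋₊ : ℝ) = ∑ k ∈ Finset.range K, block (param k) x := by
  rw [gridValue, Nat.cast_sum]
  refine Finset.sum_congr rfl fun k hk => ?_
  rw [Nat.cast_sum, block]
  refine Finset.sum_congr rfl fun i hi => ?_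
  have hH := spikeDen_pos (param_pos k) i
  obtain ⟨q, hq⟩ := spikeDen_dvd_gridDen (Finset.mem_range.1 hk)
    (Nat.lt_succ_iff.1 (Finset.mem_range.1 hi))
  have hN := gridDen_pos K
  have hH' : (0 : ℝ) < spikeDen (param k) i := by exact_mod_cast hH
  have hq0 : 0 < q := Nat.pos_of_ne_zero fun h => by simp [h] at hq; omega
  have hq' : (0 : ℝ) < q := by exact_mod_cast hq0
  have hqR : (gridDen K : ℝ) = spikeDen (param k) i * q := by exact_mod_cast hq
  have h1 (c : ℕ) : c * gridDen K ≤ ⌊x * gridDen K⌋₊ * spikeDen (param k) i ↔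
      (c : ℝ) / spikeDen (param k) i ≤ x := by
    rw [show c * gridDen K = (c * q) * spikeDen (param k) i by rw [hq]; ring,
      Nat.mul_le_mul_right_iff hH, Nat.le_floor_iff (by positivity), hqR, div_le_iff₀ hH',
      Nat.cast_mul, ← mul_assoc, mul_le_mul_iff_left₀ hq']
  have h2 := h1 (spikePos (param k) i)
  have h3 := (h1 (spikePos (param k) i + 1)).not
  rw [not_le, not_le, Nat.cast_add, Nat.cast_one] at h3
  simp only [h2, h3, spike, spikeSet, Set.indicator_apply, Set.mem_Ico]
  split_ifs <;> simp

theorem stepFunction_gridEndpoints (K : ℕ) {x : ℝ} (hx : x ∈ Set.Icc 0 (2 * Real.pi)) :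
    stepFunction (decodeEndpoints (gridEndpoints K)) x =
      ∑ k ∈ Finset.range K, block (param k) x := by
  have hN : (0 : ℝ) < gridDen K := by exact_mod_cast gridDen_pos K
  rw [decodeEndpoints_gridEndpoints, stepFunction_range (gridDen_pos K) _ _ hx.1, gridValue_eq K hx.1]
  push_cast
  have : x < 7 := by linarith [hx.2, Real.pi_lt_d2]
  nlinarith

/-! ### The Dirichlet kernel and its integrals over intervals -/

/-- The Dirichlet kernel `1/2 + cos u + ⋯ + cos mu`. -/
noncomputable def dirichlet (m : ℕ) (u : ℝ) : ℝ := 1 / 2 + ∑ n ∈ Finset.Icc 1 m, Real.cos (n * u)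

theorem continuous_dirichlet (m : ℕ) : Continuous (dirichlet m) := by
  unfold dirichlet; fun_prop

theorem dirichlet_neg (m : ℕ) (u : ℝ) : dirichlet m (-u) = dirichlet m u := by
  simp [dirichlet]

theorem two_sin_mul_dirichlet (m : ℕ) (u : ℝ) :
    2 * Real.sin (u / 2) * dirichlet m u = Real.sin ((m + 1 / 2) * u) := by
  induction m with
  | zero =>
    simp only [dirichlet, CharP.cast_eq_zero]
    simp
    ring_nf
  | succ m ih =>
    rw [dirichlet, Finset.sum_Icc_succ_top (by omega), ← add_assoc, mul_add]
    change 2 * Real.sin (u / 2) * dirichlet m u + _ = _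
    rw [ih]
    have h1 : ((m : ℝ) + 1 / 2) * u = (m + 1) * u - u / 2 := by ring
    have h2 : (((m + 1 : ℕ) : ℝ) + 1 / 2) * u = (m + 1) * u + u / 2 := by push_cast; ring
    rw [h1, h2, Real.sin_add, Real.sin_sub]
    push_cast
    ring

theorem dirichlet_eq_div {m : ℕ} {u : ℝ} (hu : Real.sin (u / 2) ≠ 0) :
    dirichlet m u = Real.sin ((m + 1 / 2) * u) * (2 * Real.sin (u / 2))⁻¹ := by
  rw [← two_sin_mul_dirichlet]
  field_simp

theorem abs_dirichlet_le (m : ℕ) (u : ℝ) : |dirichlet m u| ≤ m + 1 / 2 := by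
  have h : |∑ n ∈ Finset.Icc 1 m, Real.cos (n * u)| ≤ m := by
    refine (Finset.abs_sum_le_sum_abs _ _).trans ?_
    refine (Finset.sum_le_sum fun n _ => Real.abs_cos_le_one _).trans ?_
    simp
  rw [dirichlet]
  refine (abs_add_le _ _).trans ?_
  rw [abs_of_pos (by norm_num : (0 : ℝ) < 1 / 2)]
  linarith

/-- Each of the m cosines is Lipschitz with constant at most m. This permits replacing a narrow
spike by a point mass. -/
theorem abs_dirichlet_sub_le (m : ℕ) (u v : ℝ) :
    |dirichlet m u - dirichlet m v| ≤ (m : ℝ) ^ 2 * |u - v| := by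
  rw [dirichlet, dirichlet, add_sub_add_left_eq_sub, ← Finset.sum_sub_distrib]
  refine (Finset.abs_sum_le_sum_abs _ _).trans ?_
  have h (n) (hn : n ∈ Finset.Icc 1 m) :
      |Real.cos (n * u) - Real.cos (n * v)| ≤ m * |u - v| := by
    have h1 : |Real.cos (n * u) - Real.cos (n * v)| ≤ |n * u - n * v| := by
      simpa [Real.dist_eq] using Real.lipschitzWith_cos.dist_le_mul (n * u) (n * v)
    rw [← mul_sub, abs_mul, Nat.abs_cast] at h1
    refine h1.trans (mul_le_mul_of_nonneg_right ?_ (abs_nonneg _))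
    exact_mod_cast (Finset.mem_Icc.1 hn).2
  refine (Finset.sum_le_sum h).trans ?_
  simp [sq, mul_assoc]

theorem fourierPartialSum_eq {f : ℝ → ℝ}
    (hf : IntervalIntegrable f volume 0 (2 * Real.pi)) (m : ℕ) (x : ℝ) :
    fourierPartialSum f m x =
      (1 / Real.pi) * ∫ t in (0 : ℝ)..(2 * Real.pi), f t * dirichlet m (x - t) := by
  have hc (n : ℕ) : IntervalIntegrable (fun t => f t * Real.cos (n * t)) volume 0 (2 * Real.pi) :=
    hf.mul_continuousOn (by fun_prop)
  have hs (n : ℕ) : IntervalIntegrable (fun t => f t * Real.sin (n * t)) volume 0 (2 * Real.pi) :=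
    hf.mul_continuousOn (by fun_prop)
  have hn (n : ℕ) : IntervalIntegrable (fun t => f t * Real.cos (n * (x - t))) volume 0
      (2 * Real.pi) := hf.mul_continuousOn (by fun_prop)
  have h1 (n : ℕ) : fourierCos f n * Real.cos (n * x) + fourierSin f n * Real.sin (n * x) =
      (1 / Real.pi) * ∫ t in (0 : ℝ)..(2 * Real.pi), f t * Real.cos (n * (x - t)) := by
    rw [fourierCos, fourierSin, mul_assoc, mul_assoc, ← mul_add,
      ← intervalIntegral.integral_mul_const, ← intervalIntegral.integral_mul_const,
      ← intervalIntegral.integral_add ((hc n).mul_const _) ((hs n).mul_const _)]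
    congr 1
    refine intervalIntegral.integral_congr fun t _ => ?_
    simp only [mul_sub, Real.cos_sub]
    ring
  have h0 : fourierCos f 0 / 2 =
      (1 / Real.pi) * ∫ t in (0 : ℝ)..(2 * Real.pi), f t * (1 / 2) := by
    rw [fourierCos, intervalIntegral.integral_mul_const]
    simp
    ring
  rw [fourierPartialSum, h0, Finset.sum_congr rfl fun n _ => h1 n, ← Finset.mul_sum, ← mul_add,
    ← intervalIntegral.integral_finsetSum fun n _ => hn n,
    ← intervalIntegral.integral_add (hf.mul_const _)]
  · simp only [dirichlet, mul_add, Finset.mul_sum]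
  · simpa only [Finset.sum_fn] using IntervalIntegrable.sum (Finset.Icc 1 m) fun n _ => hn n

theorem le_sin_half {d u : ℝ} (hd : 0 < d) (h1 : d ≤ u) (h2 : u ≤ 2 * Real.pi - d) :
    d / Real.pi ≤ Real.sin (u / 2) := by
  have hpi := Real.pi_pos
  rcases le_total (u / 2) (Real.pi / 2) with h | h
  · refine le_trans ?_ (Real.mul_le_sin (by linarith) h)
    rw [div_eq_mul_inv, div_mul_eq_mul_div, div_eq_mul_inv]
    gcongr
    linarith
  · rw [← Real.sin_pi_sub]
    refine le_trans ?_ (Real.mul_le_sin (by linarith) (by linarith))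
    rw [div_eq_mul_inv, div_mul_eq_mul_div, div_eq_mul_inv]
    gcongr
    linarith

/-- Away from the multiples of 2π the kernel is sin((m + 1/2)u) times a smooth factor; one
integration by parts gains 1/(m + 1/2), and differentiating the factor costs 1/d^2. -/
theorem abs_integral_dirichlet_le {m : ℕ} {a b d : ℝ} (hd : 0 < d) (hd1 : d ≤ 1) (ha : d ≤ a)
    (hab : a ≤ b) (hb : b ≤ 2 * Real.pi - d) :
    |∫ u in a..b, dirichlet m u| ≤ 20 / ((m + 1 / 2) * d ^ 2) := by
  set M : ℝ := m + 1 / 2 with hM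
  have hM0 : 0 < M := by positivity
  have hpi := Real.pi_pos
  have hsin {u : ℝ} (hu : u ∈ Set.Icc a b) : d / Real.pi ≤ Real.sin (u / 2) :=
    le_sin_half hd (ha.trans hu.1) (hu.2.trans hb)
  have hdpi : 0 < d / Real.pi := by positivity
  have hsin0 {u : ℝ} (hu : u ∈ Set.Icc a b) : 0 < Real.sin (u / 2) := hdpi.trans_le (hsin hu)
  set F : ℝ → ℝ := fun u => (2 * Real.sin (u / 2))⁻¹
  set F' : ℝ → ℝ := fun u => -Real.cos (u / 2) / (2 * Real.sin (u / 2)) ^ 2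
  set G : ℝ → ℝ := fun u => -Real.cos (M * u) / M
  have hF : ∀ u ∈ Set.uIcc a b, HasDerivAt F (F' u) u := by
    intro u hu
    rw [Set.uIcc_of_le hab] at hu
    have h := ((((hasDerivAt_id u).div_const 2).sin).const_mul 2).inv
      (mul_pos two_pos (hsin0 hu)).ne'
    refine h.congr_deriv ?_
    simp only [F', id]
    ring
  have hG : ∀ u ∈ Set.uIcc a b, HasDerivAt G (Real.sin (M * u)) u := by
    intro u _
    have h := ((((hasDerivAt_id u).const_mul M).cos).neg).div_const M
    refine h.congr_deriv ?_
    simp only [id]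
    field_simp
  have hF'c : ContinuousOn F' (Set.uIcc a b) := by
    rw [Set.uIcc_of_le hab]
    refine ContinuousOn.div (by fun_prop) (by fun_prop) fun u hu => ?_
    have := hsin0 hu
    positivity
  have hibp := intervalIntegral.integral_mul_deriv_eq_deriv_mul hF hG hF'c.intervalIntegrable
    (by apply Continuous.intervalIntegrable; fun_prop)
  have hcongr : ∫ u in a..b, dirichlet m u = ∫ u in a..b, F u * Real.sin (M * u) := by
    refine intervalIntegral.integral_congr fun u hu => ?_
    rw [Set.uIcc_of_le hab] at hu
    simp only [F]
    rw [dirichlet_eq_div (hsin0 hu).ne', mul_comm]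
  have hGb (u : ℝ) : |G u| ≤ 1 / M := by
    simp only [G]
    rw [abs_div, abs_neg, abs_of_pos hM0]
    gcongr
    exact Real.abs_cos_le_one _
  have hFb {u : ℝ} (hu : u ∈ Set.Icc a b) : |F u| ≤ Real.pi / (2 * d) := by
    simp only [F]
    have := hsin0 hu
    rw [abs_of_pos (by positivity), show Real.pi / (2 * d) = (2 * (d / Real.pi))⁻¹ by field_simp]
    gcongr
    exact hsin hu
  have hF'b {u : ℝ} (hu : u ∈ Set.Icc a b) : |F' u| ≤ Real.pi ^ 2 / (4 * d ^ 2) := by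
    simp only [F']
    have h0 := hsin0 hu
    rw [abs_div, abs_neg, abs_of_pos (by positivity : 0 < (2 * Real.sin (u / 2)) ^ 2),
      show Real.pi ^ 2 / (4 * d ^ 2) = 1 / (2 * (d / Real.pi)) ^ 2 by field_simp; norm_num]
    gcongr
    · exact Real.abs_cos_le_one _
    · exact hsin hu
  have hint : |∫ u in a..b, F' u * G u| ≤ Real.pi ^ 2 / (4 * d ^ 2) * (1 / M) * (2 * Real.pi) := by
    have := intervalIntegral.norm_integral_le_of_norm_le_const
      (f := fun u => F' u * G u) (a := a) (b := b)
      (C := Real.pi ^ 2 / (4 * d ^ 2) * (1 / M)) fun u hu => by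
        rw [Set.uIoc_of_le hab] at hu
        rw [Real.norm_eq_abs, abs_mul]
        exact mul_le_mul (hF'b ⟨hu.1.le, hu.2⟩) (hGb u) (abs_nonneg _) (by positivity)
    refine this.trans (mul_le_mul_of_nonneg_left ?_ (by positivity))
    rw [abs_of_nonneg (by linarith)]
    linarith
  have hend {u : ℝ} (hu : u ∈ Set.Icc a b) : |F u * G u| ≤ Real.pi / (2 * d) * (1 / M) := by
    rw [abs_mul]
    exact mul_le_mul (hFb hu) (hGb u) (abs_nonneg _) (by positivity)
  rw [hcongr, hibp]
  have h1 := hend (Set.right_mem_Icc.2 hab)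
  have h2 := hend (Set.left_mem_Icc.2 hab)
  have h3 : |F b * G b - F a * G a - ∫ u in a..b, F' u * G u| ≤
      Real.pi / (2 * d) * (1 / M) + Real.pi / (2 * d) * (1 / M) +
        Real.pi ^ 2 / (4 * d ^ 2) * (1 / M) * (2 * Real.pi) := by
    refine (abs_sub _ _).trans (add_le_add ((abs_sub _ _).trans (add_le_add h1 h2)) hint)
  refine h3.trans ?_
  have h4 : Real.pi / (2 * d) * (1 / M) + Real.pi / (2 * d) * (1 / M) +
        Real.pi ^ 2 / (4 * d ^ 2) * (1 / M) * (2 * Real.pi) =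
      (Real.pi * d + Real.pi ^ 3 / 2) / (M * d ^ 2) := by
    field_simp
    ring
  rw [h4]
  gcongr
  -- The numerator is at most π + π^3/2 < 20.
  have h5 : Real.pi < 3.15 := Real.pi_lt_d2
  have h6 : Real.pi ^ 3 ≤ 3.15 ^ 3 := by gcongr
  have h7 : Real.pi * d ≤ Real.pi * 1 := by gcongr
  norm_num at h5 h6 h7
  linarith

theorem abs_integral_dirichlet_sub_le {m : ℕ} {a b d x : ℝ} (hd : 0 < d) (hd1 : d ≤ 1)
    (hab : a ≤ b) (ha : 0 ≤ a) (hb : b ≤ 2 * Real.pi) (hx : d ≤ x) (hx' : x ≤ 2 * Real.pi - d)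
    (h : x + d ≤ a ∨ b + d ≤ x) :
    |∫ t in a..b, dirichlet m (x - t)| ≤ 20 / ((m + 1 / 2) * d ^ 2) := by
  rcases h with h | h
  · have : ∫ t in a..b, dirichlet m (x - t) = ∫ u in (a - x)..(b - x), dirichlet m u := by
      rw [← intervalIntegral.integral_comp_sub_right]
      simp only [← dirichlet_neg m (x - _), neg_sub]
    rw [this]
    exact abs_integral_dirichlet_le hd hd1 (by linarith) (by linarith) (by linarith)
  · rw [intervalIntegral.integral_comp_sub_left]
    exact abs_integral_dirichlet_le hd hd1 (by linarith) (by linarith) (by linarith)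

theorem integral_dirichlet_sub (m : ℕ) (x : ℝ) :
    ∫ t in (0 : ℝ)..(2 * Real.pi), dirichlet m (x - t) = Real.pi := by
  have h (n : ℕ) (hn : n ∈ Finset.Icc 1 m) :
      ∫ t in (0 : ℝ)..(2 * Real.pi), Real.cos (n * (x - t)) = 0 := by
    have hn0 : (n : ℝ) ≠ 0 := by
      have := (Finset.mem_Icc.1 hn).1
      positivity
    rw [intervalIntegral.integral_comp_sub_left (fun u => Real.cos (n * u)),
      intervalIntegral.integral_comp_mul_left _ hn0, integral_cos, mul_sub, mul_sub,
      Real.sin_sub_nat_mul_two_pi]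
    simp
  simp only [dirichlet]
  rw [intervalIntegral.integral_add (by simp), intervalIntegral.integral_finsetSum,
    Finset.sum_congr rfl h]
  · simp
    ring
  · intro n _
    apply Continuous.intervalIntegrable; fun_prop
  · apply Continuous.intervalIntegrable; fun_prop

/-- The partial sums of the Fourier series of the indicator function of an interval are bounded
at every point that is not an endpoint. -/
theorem exists_forall_abs_integral_dirichlet_sub_le {a b x : ℝ} (ha : 0 ≤ a) (hab : a ≤ b)
    (hb : b ≤ 2 * Real.pi) (hx : 0 < x) (hx' : x < 2 * Real.pi) (hxa : x ≠ a) (hxb : x ≠ b) :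
    ∃ C, ∀ m, |∫ t in a..b, dirichlet m (x - t)| ≤ C := by
  have key {a b : ℝ} (ha : 0 ≤ a) (hab : a ≤ b) (hb : b ≤ 2 * Real.pi) (h : x < a ∨ b < x) :
      ∃ C, ∀ m, |∫ t in a..b, dirichlet m (x - t)| ≤ C := by
    obtain ⟨d, hd, hd1, hd2, hd3, hd4⟩ : ∃ d, 0 < d ∧ d ≤ 1 ∧ d ≤ x ∧ x ≤ 2 * Real.pi - d ∧
        (x + d ≤ a ∨ b + d ≤ x) := by
      rcases h with h | h
      · refine ⟨min (min 1 x) (min (2 * Real.pi - x) (a - x)), ?_, ?_, ?_, ?_, Or.inl ?_⟩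
        · simp [hx, hx', h]
        · simp
        · simp
        · have : min (min 1 x) (min (2 * Real.pi - x) (a - x)) ≤ 2 * Real.pi - x := by simp
          linarith
        · have : min (min 1 x) (min (2 * Real.pi - x) (a - x)) ≤ a - x := by simp
          linarith
      · refine ⟨min (min 1 x) (min (2 * Real.pi - x) (x - b)), ?_, ?_, ?_, ?_, Or.inr ?_⟩
        · simp [hx, hx', h]
        · simp
        · simp
        · have : min (min 1 x) (min (2 * Real.pi - x) (x - b)) ≤ 2 * Real.pi - x := by simp
          linarith
        · have : min (min 1 x) (min (2 * Real.pi - x) (x - b)) ≤ x - b := by simp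
          linarith
    refine ⟨20 / (1 / 2 * d ^ 2), fun m =>
      (abs_integral_dirichlet_sub_le hd hd1 hab ha hb hd2 hd3 hd4).trans ?_⟩
    gcongr
    simp
  rcases lt_or_gt_of_ne hxa with h | h
  · exact key ha hab hb (Or.inl h)
  rcases lt_or_gt_of_ne hxb with h' | h'
  -- For x inside the interval, the integral is π, its value over the full period, minus the
  -- integrals over the two complementary intervals, which avoid x.
  · obtain ⟨C₁, hC₁⟩ := key le_rfl ha (hab.trans hb) (Or.inr h)
    obtain ⟨C₂, hC₂⟩ := key (ha.trans hab) hb le_rfl (Or.inl h')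
    refine ⟨Real.pi + C₁ + C₂, fun m => ?_⟩
    have hi (a b : ℝ) : IntervalIntegrable (fun t => dirichlet m (x - t)) volume a b := by
      have := continuous_dirichlet m
      apply Continuous.intervalIntegrable; fun_prop
    have h1 := intervalIntegral.integral_add_adjacent_intervals (hi 0 a) (hi a b)
    have h2 := intervalIntegral.integral_add_adjacent_intervals (hi 0 b) (hi b (2 * Real.pi))
    rw [integral_dirichlet_sub] at h2
    have h3 := abs_le.1 (hC₁ m)
    have h4 := abs_le.1 (hC₂ m)
    have := Real.pi_pos
    exact abs_le.2 ⟨by linarith, by linarith⟩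
  · exact key ha hab hb (Or.inr h')

/-! ### Growth of the parameters -/

theorem two_mul_lt_blockBase (Q : ℕ) : 2 * Q < blockBase Q := by
  have h1 : Q < 2 ^ Q := Nat.lt_two_pow_self
  have h2 : 2 ^ Q ≤ 2 ^ Q ^ 3 := Nat.pow_le_pow_right (by norm_num) (Nat.le_self_pow (by norm_num) Q)
  unfold blockBase blockSize
  omega

theorem blockBase_le_blockScale {Q : ℕ} (hQ : 0 < Q) : blockBase Q ≤ blockScale Q :=
  Nat.le_mul_of_pos_left _ hQ

theorem le_blockScale (Q : ℕ) : Q ≤ blockScale Q :=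
  Nat.le_mul_of_pos_right _ (blockBase_pos Q)

theorem two_mul_param_le (k : ℕ) : 2 * param k ≤ param (k + 1) := by
  have h1 := (two_mul_lt_blockBase (param k)).le.trans (blockBase_le_blockScale (param_pos k))
  exact h1.trans (Nat.le_self_pow (by omega) _)

theorem param_mono : Monotone param :=
  monotone_nat_of_le_succ fun k => by have := two_mul_param_le k; omega

theorem le_param (k : ℕ) : 41 ≤ param k := by
  simpa [param] using param_mono (Nat.zero_le k)

theorem two_pow_mul_param_le (K k : ℕ) : 2 ^ k * param K ≤ param (K + k) := by
  induction k with
  | zero => simp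
  | succ k ih =>
    have := two_mul_param_le (K + k)
    rw [pow_succ]
    calc 2 ^ k * 2 * param K = 2 * (2 ^ k * param K) := by ring
      _ ≤ 2 * param (K + k) := by omega
      _ ≤ _ := this

theorem two_pow_le_param (k : ℕ) : 2 ^ k ≤ param k := by
  have := two_pow_mul_param_le 0 k
  rw [zero_add] at this
  exact (Nat.le_mul_of_pos_right _ (param_pos 0)).trans this

theorem odd_blockBase (Q : ℕ) : Odd (blockBase Q) := ⟨_, rfl⟩

theorem odd_param (k : ℕ) : Odd (param k) := by
  induction k with
  | zero => exact ⟨20, rfl⟩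
  | succ k ih => exact (ih.mul (odd_blockBase _)).pow

theorem odd_freq {Q : ℕ} (hQ : Odd Q) (i : ℕ) : Odd (freq Q i) :=
  (odd_blockBase Q).mul (hQ.mul (odd_blockBase Q)).pow

theorem freq_pos {Q : ℕ} (hQ : 0 < Q) (i : ℕ) : 0 < freq Q i :=
  Nat.mul_pos (blockBase_pos Q) (Nat.pow_pos (blockScale_pos hQ))

theorem exponent_mono {i j : ℕ} (h : i ≤ j) : 12 * 3 ^ i ≤ 12 * 3 ^ j :=
  Nat.mul_le_mul_left _ (Nat.pow_le_pow_right (by norm_num) h)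

/-- The factor 40b^4 comes from `abs_integral_dirichlet_le` with d = 1/b^2, where m + 1/2 is half a
frequency; here it is absorbed into β^5. -/
theorem mul_spikeDen_le {Q : ℕ} (hQ : 41 ≤ Q) (i : ℕ) :
    40 * blockBase Q ^ 4 * spikeDen Q i ≤ blockScale Q ^ (12 * 3 ^ i + 5) := by
  have h1 : 40 ≤ blockScale Q := by have := le_blockScale Q; omega
  have h2 := Nat.pow_le_pow_left (blockBase_le_blockScale (Q := Q) (by omega)) 4
  calc 40 * blockBase Q ^ 4 * spikeDen Q i
      ≤ blockScale Q * blockScale Q ^ 4 * spikeDen Q i := by gcongr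
    _ = _ := by rw [spikeDen]; ring

theorem mul_spikeDen_le_freq {Q i j : ℕ} (hQ : 41 ≤ Q) (h : i ≤ j) :
    40 * blockBase Q ^ 4 * spikeDen Q i ≤ freq Q j := by
  have hβ := blockScale_pos (Q := Q) (by omega)
  refine (mul_spikeDen_le hQ i).trans ((Nat.pow_le_pow_right hβ ?_).trans
    (Nat.le_mul_of_pos_left _ (blockBase_pos Q)))
  have := exponent_mono h
  omega

theorem mul_spikeDen_le_freq_of_lt {k' k i : ℕ} (h : k' < k) (hi : i ≤ blockSize (param k'))
    (j : ℕ) :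
    40 * blockBase (param k') ^ 4 * spikeDen (param k') i ≤ freq (param k) j := by
  refine (mul_spikeDen_le (le_param k') i).trans ?_
  have h1 : blockScale (param k') ^ (12 * 3 ^ i + 5) ≤ param (k' + 1) := by
    refine Nat.pow_le_pow_right (blockScale_pos (param_pos k')) ?_
    have := exponent_mono hi
    omega
  refine h1.trans ((param_mono h).trans ?_)
  have h2 := two_mul_lt_blockBase (param k)
  have h3 : blockBase (param k) ≤ freq (param k) j :=
    Nat.le_mul_of_pos_right _ (Nat.pow_pos (blockScale_pos (param_pos k)))
  exact le_trans (by omega) h3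

theorem freq_le_param {k j : ℕ} (hj : j ≤ blockSize (param k)) :
    freq (param k) j ≤ param (k + 1) := by
  have hβ := blockScale_pos (param_pos k)
  calc freq (param k) j ≤ blockScale (param k) * blockScale (param k) ^ (12 * 3 ^ j + 5) :=
        Nat.mul_le_mul_right _ (blockBase_le_blockScale (param_pos k))
    _ = blockScale (param k) ^ (12 * 3 ^ j + 6) := by ring
    _ ≤ _ := by
      refine Nat.pow_le_pow_right hβ ?_
      have := exponent_mono hj
      omega

/-- This is why the exponents triple: doubling 12·3^j + 5 and adding 2 for b^2 gives 24·3^j + 12,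
which is at most 12·3^(j+1). It makes spike i narrow enough to be a point mass for the frequency of
any j < i. -/
theorem freq_sq_le {Q i j : ℕ} (hQ : 0 < Q) (h : j < i) : freq Q j ^ 2 ≤ spikeDen Q i := by
  have hβ := blockScale_pos hQ
  have h1 := Nat.pow_le_pow_left (blockBase_le_blockScale hQ) 2
  calc freq Q j ^ 2 = blockBase Q ^ 2 * blockScale Q ^ (2 * (12 * 3 ^ j + 5)) := by
        rw [freq]; ring
    _ ≤ blockScale Q ^ 2 * blockScale Q ^ (2 * (12 * 3 ^ j + 5)) := Nat.mul_le_mul_right _ h1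
    _ = blockScale Q ^ (2 * (12 * 3 ^ j) + 12) := by ring
    _ ≤ _ := by
      refine Nat.pow_le_pow_right hβ ?_
      have := exponent_mono (Nat.succ_le_of_lt h)
      rw [pow_succ] at this
      have h3 : 0 < 3 ^ j := by positivity
      omega

theorem two_mul_sq_le_spikeDen {Q : ℕ} (hQ : 41 ≤ Q) (i : ℕ) :
    2 * blockBase Q ^ 2 ≤ spikeDen Q i := by
  have hβ := blockScale_pos (Q := Q) (by omega)
  have h1 : 2 ≤ blockScale Q := by have := le_blockScale Q; omega
  have h2 := Nat.pow_le_pow_left (blockBase_le_blockScale (Q := Q) (by omega)) 2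
  calc 2 * blockBase Q ^ 2 ≤ blockScale Q * blockScale Q ^ 2 := by gcongr
    _ = blockScale Q ^ 3 := by ring
    _ ≤ _ := by
      refine Nat.pow_le_pow_right hβ ?_
      have : 0 < 3 ^ i := by positivity
      omega

theorem spikeHeight_eq {Q : ℕ} (hQ : 0 < Q) (i : ℕ) :
    (spikeHeight Q i : ℝ) = spikeDen Q i / blockScale Q := by
  have hβ : (0 : ℝ) < blockScale Q := by exact_mod_cast blockScale_pos hQ
  rw [eq_div_iff hβ.ne', spikeHeight, spikeDen]
  have : 0 < 3 ^ i := by positivity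
  exact_mod_cast pow_sub_one_mul (M := ℕ) (by omega) _

theorem blockSize_add_one_div_le {Q : ℕ} (hQ : 0 < Q) :
    ((blockSize Q + 1 : ℕ) : ℝ) / blockScale Q ≤ 1 / Q := by
  have hb : (0 : ℝ) < blockBase Q := by exact_mod_cast blockBase_pos Q
  have hQ' : (0 : ℝ) < Q := by exact_mod_cast hQ
  rw [blockScale, Nat.cast_mul, div_le_div_iff₀ (by positivity) hQ', one_mul, mul_comm]
  gcongr
  unfold blockBase
  omega

theorem summable_inv_param : Summable fun k => 1 / (param k : ℝ) := by
  refine Summable.of_nonneg_of_le (fun k => by positivity) (fun k => ?_)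
    summable_geometric_two
  rw [one_div_pow]
  exact one_div_le_one_div_of_le (by positivity) (by exact_mod_cast two_pow_le_param k)

theorem tsum_inv_param_le (K : ℕ) : ∑' k, 1 / (param (k + K) : ℝ) ≤ 2 / param K := by
  have hK : (0 : ℝ) < param K := by exact_mod_cast param_pos K
  calc ∑' k, 1 / (param (k + K) : ℝ) ≤ ∑' k, (1 / 2 : ℝ) ^ k * (1 / param K) := by
        refine Summable.tsum_le_tsum (fun k => ?_) ((summable_nat_add_iff K).2 summable_inv_param)
          (summable_geometric_two.mul_right _)
        rw [one_div_pow, one_div_mul_one_div]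
        refine one_div_le_one_div_of_le (by positivity) ?_
        rw [add_comm k]
        exact_mod_cast two_pow_mul_param_le K k
    _ = 2 / param K := by rw [tsum_mul_right, tsum_geometric_two]; ring

/-! ### The position of the spikes -/

/-- The point approximated by the `i`-th spike. -/
noncomputable def node (Q i : ℕ) : ℝ := 4 * Real.pi * i / blockBase Q

theorem spikePos_le {Q : ℕ} (hQ : 0 < Q) (i : ℕ) :
    (spikePos Q i : ℝ) / spikeDen Q i ≤ node Q i := by
  have hH : (0 : ℝ) < spikeDen Q i := by exact_mod_cast spikeDen_pos hQ i
  have hb : (0 : ℝ) < blockBase Q := by exact_mod_cast blockBase_pos Q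
  rw [div_le_iff₀ hH]
  have h1 : (spikePos Q i : ℝ) ≤ (piApprox (spikeDen Q i * i) : ℝ) / blockBase Q :=
    Nat.cast_div_le
  have h2 := piApprox_le (spikeDen Q i * i)
  refine h1.trans ?_
  rw [div_le_iff₀ hb, node]
  push_cast at h2
  have : 4 * Real.pi * i / blockBase Q * spikeDen Q i * blockBase Q =
    4 * Real.pi * (spikeDen Q i * i) := by field_simp
  linarith

theorem lt_spikePos {Q : ℕ} (hQ : 0 < Q) (i : ℕ) :
    node Q i - 2 / spikeDen Q i < (spikePos Q i : ℝ) / spikeDen Q i := by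
  have hH : (0 : ℝ) < spikeDen Q i := by exact_mod_cast spikeDen_pos hQ i
  have hb : (0 : ℝ) < blockBase Q := by exact_mod_cast blockBase_pos Q
  have hb2 : (2 : ℝ) < blockBase Q := by
    exact_mod_cast (show 2 < blockBase Q by have := two_mul_lt_blockBase Q; omega)
  rw [lt_div_iff₀ hH]
  have h1 : (piApprox (spikeDen Q i * i) : ℝ) < (spikePos Q i + 1) * blockBase Q := by
    have := Nat.lt_mul_div_succ (piApprox (spikeDen Q i * i)) (blockBase_pos Q)
    rw [mul_comm (blockBase Q)] at this
    rw [spikePos]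
    exact_mod_cast this
  have h2 := lt_piApprox (spikeDen Q i * i)
  push_cast at h2
  have h3 : (node Q i - 2 / spikeDen Q i) * spikeDen Q i * blockBase Q =
      4 * Real.pi * (spikeDen Q i * i) - 2 * blockBase Q := by rw [node]; field_simp
  refine lt_of_mul_lt_mul_right ?_ hb.le
  rw [h3]
  -- Two roundings occur: less than 2/b from `piApprox` and less than 1 from the division. Their sum
  -- is below 2 because b > 2.
  nlinarith

theorem abs_sub_node_le {Q i : ℕ} (hQ : 0 < Q) {t : ℝ}
    (ht : t ∈ Set.Icc ((spikePos Q i : ℝ) / spikeDen Q i) ((spikePos Q i + 1) / spikeDen Q i)) :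
    |t - node Q i| ≤ 2 / spikeDen Q i := by
  have hH : (0 : ℝ) < spikeDen Q i := by exact_mod_cast spikeDen_pos hQ i
  have h1 := spikePos_le hQ i
  have h2 := lt_spikePos hQ i
  have h3 : (0 : ℝ) < 1 / spikeDen Q i := by positivity
  have h4 : (2 : ℝ) / spikeDen Q i = 1 / spikeDen Q i + 1 / spikeDen Q i := by ring
  have h5 := ht.2
  rw [add_div] at h5
  exact abs_le.2 ⟨by linarith [ht.1], by linarith⟩

theorem spikePos_add_one_le {Q i : ℕ} (hQ : 41 ≤ Q) (hi : i ≤ blockSize Q) :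
    ((spikePos Q i : ℝ) + 1) / spikeDen Q i ≤ 2 * Real.pi := by
  have hb : (0 : ℝ) < blockBase Q := by exact_mod_cast blockBase_pos Q
  have h1 := spikePos_le (Q := Q) (by omega) i
  have h2 : (blockBase Q : ℝ) ≤ spikeDen Q i := by
    have := two_mul_sq_le_spikeDen hQ i
    have h3 := Nat.le_self_pow (n := 2) (by norm_num) (blockBase Q)
    exact_mod_cast (show blockBase Q ≤ spikeDen Q i by omega)
  have h3 : (1 : ℝ) / spikeDen Q i ≤ 1 / blockBase Q := one_div_le_one_div_of_le hb h2
  have h4 : node Q i + 1 / blockBase Q ≤ 2 * Real.pi := by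
    rw [node, ← add_div, div_le_iff₀ hb]
    have h5 : (i : ℝ) ≤ blockSize Q := by exact_mod_cast hi
    rw [blockBase]
    push_cast
    nlinarith [Real.pi_gt_three]
  rw [add_div]
  linarith

theorem spikeSet_subset {Q i : ℕ} (hQ : 41 ≤ Q) (hi : i ≤ blockSize Q) :
    spikeSet Q i ⊆ Set.Ico 0 (2 * Real.pi) :=
  Set.Ico_subset_Ico (by positivity) (spikePos_add_one_le hQ hi)

/-! ### Integrability and computability of the sum of the blocks -/

/-- The sum of all blocks, a function with an almost everywhere divergent Fourier series. -/
noncomputable def blockSum (x : ℝ) : ℝ := ∑' k, block (param k) x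

theorem measurableSet_spikeSet (Q i : ℕ) : MeasurableSet (spikeSet Q i) := measurableSet_Ico

theorem measurable_spike (Q i : ℕ) : Measurable (spike Q i) :=
  measurable_const.indicator (measurableSet_spikeSet Q i)

theorem measurable_block (Q : ℕ) : Measurable (block Q) :=
  Finset.measurable_fun_sum _ fun i _ => measurable_spike Q i

theorem spike_nonneg (Q i : ℕ) (x : ℝ) : 0 ≤ spike Q i x :=
  Set.indicator_nonneg (fun _ _ => by positivity) x

theorem block_nonneg (Q : ℕ) (x : ℝ) : 0 ≤ block Q x :=
  Finset.sum_nonneg fun i _ => spike_nonneg Q i x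

theorem integral_circleMeasure (g : ℝ → ℝ) :
    ∫ t, g t ∂circleMeasure = ∫ t in (0 : ℝ)..(2 * Real.pi), g t := by
  rw [circleMeasure, intervalIntegral.integral_of_le Real.two_pi_pos.le,
    integral_Icc_eq_integral_Ioc]

instance : IsFiniteMeasure circleMeasure := by
  unfold circleMeasure; infer_instance

theorem integrable_spike (Q i : ℕ) : Integrable (spike Q i) circleMeasure :=
  (integrable_const _).indicator (measurableSet_spikeSet Q i)

theorem integrable_block (Q : ℕ) : Integrable (block Q) circleMeasure :=
  integrable_finsetSum _ fun i _ => integrable_spike Q i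

/-- The mean of `t ↦ D_m(x - t)` over the `i`-th spike. -/
noncomputable def spikeMean (Q i m : ℕ) (x : ℝ) : ℝ :=
  spikeDen Q i * ∫ t in ((spikePos Q i : ℝ) / spikeDen Q i)..((spikePos Q i + 1) / spikeDen Q i),
    dirichlet m (x - t)

theorem spike_endpoints_le (Q i : ℕ) :
    (spikePos Q i : ℝ) / spikeDen Q i ≤ (spikePos Q i + 1) / spikeDen Q i := by
  gcongr
  linarith

theorem integral_spike_mul {Q i : ℕ} (hQ : 41 ≤ Q) (hi : i ≤ blockSize Q) (g : ℝ → ℝ) :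
    ∫ t, spike Q i t * g t ∂circleMeasure = spikeHeight Q i *
      ∫ t in ((spikePos Q i : ℝ) / spikeDen Q i)..((spikePos Q i + 1) / spikeDen Q i), g t := by
  have h1 : (fun t => spike Q i t * g t) =
      (spikeSet Q i).indicator (fun t => spikeHeight Q i * g t) := by
    ext t
    by_cases ht : t ∈ spikeSet Q i <;> simp [spike, ht]
  have h2 : spikeSet Q i ∩ Set.Icc 0 (2 * Real.pi) = spikeSet Q i :=
    Set.inter_eq_left.2 ((spikeSet_subset hQ hi).trans Set.Ico_subset_Icc_self)
  rw [h1, integral_indicator (measurableSet_spikeSet Q i), circleMeasure,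
    Measure.restrict_restrict (measurableSet_spikeSet Q i), h2, integral_const_mul, spikeSet,
    integral_Ico_eq_integral_Ioc, intervalIntegral.integral_of_le (spike_endpoints_le Q i)]

theorem integral_block_mul {Q : ℕ} (hQ : 41 ≤ Q) {g : ℝ → ℝ} (hg : Continuous g) :
    ∫ t, block Q t * g t ∂circleMeasure = ∑ i ∈ Finset.range (blockSize Q + 1), spikeHeight Q i *
      ∫ t in ((spikePos Q i : ℝ) / spikeDen Q i)..((spikePos Q i + 1) / spikeDen Q i), g t := by
  simp only [block, Finset.sum_mul]
  rw [integral_finsetSum]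
  · refine Finset.sum_congr rfl fun i hi => integral_spike_mul hQ ?_ g
    exact Nat.lt_succ_iff.1 (Finset.mem_range.1 hi)
  · intro i _
    have h : IntegrableOn (fun t => spike Q i t * g t) (Set.Icc 0 (2 * Real.pi)) volume :=
      IntegrableOn.mul_continuousOn (integrable_spike Q i) hg.continuousOn isCompact_Icc
    exact h

theorem integral_block_le {Q : ℕ} (hQ : 41 ≤ Q) : ∫ t, block Q t ∂circleMeasure ≤ 1 / Q := by
  have h := integral_block_mul hQ (g := fun _ => 1) continuous_const
  simp only [mul_one] at h
  rw [h]
  refine le_trans (le_of_eq ?_) (blockSize_add_one_div_le (Q := Q) (by omega))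
  rw [Finset.sum_congr rfl (g := fun _ => 1 / (blockScale Q : ℝ)) fun i _ => ?_]
  · simp [div_eq_mul_inv]
  · have hH : (0 : ℝ) < spikeDen Q i := by exact_mod_cast spikeDen_pos (Q := Q) (by omega) i
    rw [spikeHeight_eq (by omega)]
    simp only [intervalIntegral.integral_const, smul_eq_mul, mul_one]
    field_simp
    ring

theorem lintegral_block_le {Q : ℕ} (hQ : 41 ≤ Q) :
    ∫⁻ t, ‖block Q t‖ₑ ∂circleMeasure ≤ ENNReal.ofReal (1 / Q) := by
  refine le_trans (le_of_eq ?_) (ENNReal.ofReal_le_ofReal (integral_block_le hQ))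
  rw [ofReal_integral_eq_lintegral_ofReal (integrable_block Q)
    (Eventually.of_forall (block_nonneg Q))]
  simp only [Real.enorm_of_nonneg (block_nonneg Q _)]

/-- Block integrals are at most 1/`param`, and the parameters at least double at each step, so the
tail is dominated by a geometric series. -/
theorem lintegral_tsum_block_le (K : ℕ) :
    ∫⁻ t, ∑' k, ‖block (param (k + K)) t‖ₑ ∂circleMeasure ≤ ENNReal.ofReal (2 / param K) := by
  rw [lintegral_tsum fun k => (measurable_block _).enorm.aemeasurable]
  calc ∑' k, ∫⁻ t, ‖block (param (k + K)) t‖ₑ ∂circleMeasure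
      ≤ ∑' k, ENNReal.ofReal (1 / param (k + K)) :=
        ENNReal.tsum_le_tsum fun k => lintegral_block_le (le_param _)
    _ = ENNReal.ofReal (∑' k, 1 / (param (k + K) : ℝ)) :=
        (ENNReal.ofReal_tsum_of_nonneg (fun _ => by positivity)
          ((summable_nat_add_iff K).2 summable_inv_param)).symm
    _ ≤ _ := ENNReal.ofReal_le_ofReal (tsum_inv_param_le K)

theorem ae_summable_block : ∀ᵐ x ∂circleMeasure, Summable fun k => block (param k) x := by
  have h := lintegral_tsum_block_le 0
  have h1 := ae_lt_top' (Measurable.aemeasurable <| Measurable.tsum fun k =>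
    (measurable_block (param (k + 0))).enorm) (h.trans_lt ENNReal.ofReal_lt_top).ne
  filter_upwards [h1] with x hx
  exact (ENNReal.tsum_coe_ne_top_iff_summable.1 hx.ne).of_nnnorm

theorem lintegral_sub_blockSum_le (K : ℕ) :
    ∫⁻ x, ‖∑ k ∈ Finset.range K, block (param k) x - blockSum x‖ₑ ∂circleMeasure ≤
      ENNReal.ofReal (2 / param K) := by
  refine le_trans (lintegral_mono_ae ?_) (lintegral_tsum_block_le K)
  filter_upwards [ae_summable_block] with x hx
  rw [← enorm_neg, neg_sub, blockSum, ← hx.sum_add_tsum_nat_add K, add_sub_cancel_left]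
  exact enorm_tsum_le_tsum_enorm

theorem aestronglyMeasurable_blockSum : AEStronglyMeasurable blockSum circleMeasure := by
  refine aestronglyMeasurable_of_tendsto_ae (u := atTop)
    (f := fun K x => ∑ k ∈ Finset.range K, block (param k) x)
    (fun K => (Finset.measurable_fun_sum _ fun k _ => measurable_block _).aestronglyMeasurable) ?_
  filter_upwards [ae_summable_block] with x hx
  exact hx.hasSum.tendsto_sum_nat

theorem integrable_blockSum : Integrable blockSum circleMeasure := by
  refine ⟨aestronglyMeasurable_blockSum, ?_⟩
  have h := lintegral_sub_blockSum_le 0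
  simp only [Finset.range_zero, Finset.sum_empty, zero_sub, enorm_neg] at h
  exact h.trans_lt ENNReal.ofReal_lt_top

theorem isComputableLp_blockSum : IsComputableLp 1 blockSum := by
  refine ⟨by simpa using memLp_one_iff_integrable.2 integrable_blockSum,
    fun m => gridEndpoints (m + 1), (primrec_gridEndpoints.comp Primrec.succ).to_comp,
    fun m => ⟨pairwise_gridEndpoints _, ?_⟩⟩
  simp only [PNat.one_coe, Nat.cast_one, eLpNorm_one_eq_lintegral_enorm]
  have h1 : ∫⁻ x, ‖stepFunction (decodeEndpoints (gridEndpoints (m + 1))) x - blockSum x‖ₑ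
      ∂circleMeasure = ∫⁻ x, ‖∑ k ∈ Finset.range (m + 1), block (param k) x - blockSum x‖ₑ
      ∂circleMeasure := by
    refine setLIntegral_congr_fun measurableSet_Icc fun x hx => ?_
    simp only [stepFunction_gridEndpoints _ hx]
  rw [h1]
  refine (lintegral_sub_blockSum_le (m + 1)).trans_lt ?_
  have hm : (2 : ℝ) ^ (-(m : ℤ)) = 1 / 2 ^ m := by simp
  rw [hm, ENNReal.ofReal_lt_ofReal_iff (by positivity)]
  have h2 : (41 * 2 ^ (m + 1) : ℝ) ≤ param (m + 1) := by
    have := two_pow_mul_param_le 0 (m + 1)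
    rw [zero_add, mul_comm] at this
    exact_mod_cast (Nat.mul_le_mul_right _ (le_param 0)).trans this
  have h3 : (0 : ℝ) < 2 ^ m := by positivity
  rw [div_lt_div_iff₀ (lt_of_lt_of_le (by positivity) h2) h3, one_mul]
  rw [pow_succ] at h2
  linarith

/-! ### Partial sums as sums of spike means -/

theorem hasSum_fourierPartialSum (m : ℕ) (x : ℝ) :
    HasSum (fun k => 1 / (blockScale (param k) : ℝ) *
      ∑ i ∈ Finset.range (blockSize (param k) + 1), spikeMean (param k) i m x)
      (Real.pi * fourierPartialSum blockSum m x) := by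
  have hD : Continuous fun t => dirichlet m (x - t) := by
    have := continuous_dirichlet m
    fun_prop
  have hint (k : ℕ) : Integrable (fun t => block (param k) t * dirichlet m (x - t))
      circleMeasure := by
    have h : IntegrableOn (fun t => block (param k) t * dirichlet m (x - t))
        (Set.Icc 0 (2 * Real.pi)) volume :=
      IntegrableOn.mul_continuousOn (integrable_block (param k)) hD.continuousOn isCompact_Icc
    exact h
  -- For fixed m the kernel is bounded by m + 1/2, so the series of norms is dominated by that of
  -- the block integrals; this justifies integrating term by term.
  have hsum : Summable fun k => ∫ t, ‖block (param k) t * dirichlet m (x - t)‖ ∂circleMeasure := by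
    refine Summable.of_nonneg_of_le (fun k => integral_nonneg fun t => norm_nonneg _)
      (fun k => ?_) (summable_inv_param.mul_right ((m : ℝ) + 1 / 2))
    calc ∫ t, ‖block (param k) t * dirichlet m (x - t)‖ ∂circleMeasure
        ≤ ∫ t, block (param k) t * (m + 1 / 2) ∂circleMeasure := by
          refine integral_mono (hint k).norm ((integrable_block _).mul_const _) fun t => ?_
          simp only [norm_mul, Real.norm_eq_abs, abs_of_nonneg (block_nonneg _ t)]
          exact mul_le_mul_of_nonneg_left (abs_dirichlet_le _ _) (block_nonneg _ t)
      _ ≤ _ := by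
          rw [integral_mul_const]
          exact mul_le_mul_of_nonneg_right (integral_block_le (le_param k)) (by positivity)
  have h := hasSum_integral_of_summable_integral_norm hint hsum
  have hf : IntervalIntegrable blockSum volume 0 (2 * Real.pi) := by
    rw [intervalIntegrable_iff_integrableOn_Icc_of_le Real.two_pi_pos.le]
    exact integrable_blockSum
  rw [fourierPartialSum_eq hf, ← mul_assoc, mul_one_div_cancel Real.pi_ne_zero, one_mul,
    ← integral_circleMeasure]
  simp only [blockSum, ← tsum_mul_right]
  refine h.congr_fun fun k => ?_
  rw [integral_block_mul (le_param k) hD, Finset.mul_sum]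
  refine Finset.sum_congr rfl fun i _ => ?_
  rw [spikeMean, spikeHeight_eq (param_pos k)]
  ring

/-- The order of the partial sum used between the spikes `i` and `i + 1`. -/
def order (Q i : ℕ) : ℕ := freq Q i / 2

theorem order_add_half {Q : ℕ} (hQ : Odd Q) (i : ℕ) :
    (order Q i : ℝ) + 1 / 2 = freq Q i / 2 := by
  have h : (2 * order Q i + 1 : ℝ) = freq Q i := by
    exact_mod_cast Nat.two_mul_div_two_add_one_of_odd (odd_freq hQ i)
  linarith

theorem intervalIntegrable_dirichlet_sub (m : ℕ) (x a b : ℝ) :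
    IntervalIntegrable (fun t => dirichlet m (x - t)) volume a b := by
  have := continuous_dirichlet m
  apply Continuous.intervalIntegrable
  fun_prop

theorem abs_spikeMean_sub_le {Q : ℕ} (hQ : 0 < Q) {i m : ℕ} {x c C : ℝ}
    (h : ∀ t ∈ Set.Icc ((spikePos Q i : ℝ) / spikeDen Q i) ((spikePos Q i + 1) / spikeDen Q i),
      |dirichlet m (x - t) - c| ≤ C) : |spikeMean Q i m x - c| ≤ C := by
  have hH : (0 : ℝ) < spikeDen Q i := by exact_mod_cast spikeDen_pos hQ i
  have hlen : ((spikePos Q i : ℝ) + 1) / spikeDen Q i - spikePos Q i / spikeDen Q i =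
      1 / spikeDen Q i := by ring
  have h1 : spikeMean Q i m x - c = spikeDen Q i *
      ∫ t in ((spikePos Q i : ℝ) / spikeDen Q i)..((spikePos Q i + 1) / spikeDen Q i),
        (dirichlet m (x - t) - c) := by
    rw [intervalIntegral.integral_sub (intervalIntegrable_dirichlet_sub _ _ _ _) (by simp),
      intervalIntegral.integral_const, hlen, spikeMean, smul_eq_mul]
    field_simp
  have h2 := intervalIntegral.norm_integral_le_of_norm_le_const
    (f := fun t => dirichlet m (x - t) - c) (a := (spikePos Q i : ℝ) / spikeDen Q i)
    (b := (spikePos Q i + 1) / spikeDen Q i) (C := C) fun t ht => by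
      rw [Set.uIoc_of_le (spike_endpoints_le Q i)] at ht
      exact h t ⟨ht.1.le, ht.2⟩
  rw [hlen, abs_of_pos (by positivity), Real.norm_eq_abs] at h2
  rw [h1, abs_mul, Nat.abs_cast]
  calc _ ≤ (spikeDen Q i : ℝ) * (C * (1 / spikeDen Q i)) := mul_le_mul_of_nonneg_left h2 hH.le
    _ = C := by field_simp

theorem abs_spikeMean_le {Q : ℕ} (hQ : 0 < Q) (i m : ℕ) (x : ℝ) :
    |spikeMean Q i m x| ≤ m + 1 / 2 := by
  simpa using abs_spikeMean_sub_le hQ (c := 0) (i := i) (x := x) fun t _ => by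
    simpa using abs_dirichlet_le m (x - t)

/-- The endpoints of a spike are rational, so an irrational x avoids them. The bound depends on x
and serves only for the finitely many blocks at which x is not regular. -/
theorem exists_forall_abs_spikeMean_le {Q i : ℕ} (hQ : 41 ≤ Q) (hi : i ≤ blockSize Q) {x : ℝ}
    (hx : Irrational x) (hx0 : 0 < x) (hx1 : x < 2 * Real.pi) :
    ∃ C, ∀ m, |spikeMean Q i m x| ≤ C := by
  have h1 : x ≠ (spikePos Q i : ℝ) / spikeDen Q i := by
    have := hx.ne_rat ((spikePos Q i : ℚ) / spikeDen Q i)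
    push_cast at this
    exact this
  have h2 : x ≠ ((spikePos Q i : ℝ) + 1) / spikeDen Q i := by
    have := hx.ne_rat (((spikePos Q i : ℚ) + 1) / spikeDen Q i)
    push_cast at this
    exact this
  obtain ⟨C, hC⟩ := exists_forall_abs_integral_dirichlet_sub_le (by positivity)
    (spike_endpoints_le Q i) (spikePos_add_one_le hQ hi) hx0 hx1 h1 h2
  refine ⟨spikeDen Q i * C, fun m => ?_⟩
  rw [spikeMean, abs_mul, Nat.abs_cast]
  exact mul_le_mul_of_nonneg_left (hC m) (by positivity)

theorem two_div_spikeDen_le {Q : ℕ} (hQ : 41 ≤ Q) (i : ℕ) :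
    2 / (spikeDen Q i : ℝ) ≤ 1 / (blockBase Q : ℝ) ^ 2 := by
  have hH : (0 : ℝ) < spikeDen Q i := by exact_mod_cast spikeDen_pos (Q := Q) (by omega) i
  have hb : (0 : ℝ) < blockBase Q := by exact_mod_cast blockBase_pos Q
  rw [div_le_div_iff₀ hH (by positivity), one_mul]
  exact_mod_cast two_mul_sq_le_spikeDen hQ i

/-- The mean of the Dirichlet kernel over a spike is bounded away from the spike, for all orders
that are large with respect to the width of the spike. -/
theorem abs_spikeMean_le_one {Q i m F : ℕ} (hQ : 41 ≤ Q) (hi : i ≤ blockSize Q)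
    (hm : (m : ℝ) + 1 / 2 = F / 2) (hF : 40 * blockBase Q ^ 4 * spikeDen Q i ≤ F) {x : ℝ}
    (hx0 : 1 / (blockBase Q : ℝ) ^ 2 ≤ x) (hx1 : x ≤ 2 * Real.pi - 1 / (blockBase Q : ℝ) ^ 2)
    (hx : 2 / (blockBase Q : ℝ) ^ 2 < |x - node Q i|) : |spikeMean Q i m x| ≤ 1 := by
  have hQ0 : 0 < Q := by omega
  have hH : (0 : ℝ) < spikeDen Q i := by exact_mod_cast spikeDen_pos hQ0 i
  have hb : (1 : ℝ) ≤ blockBase Q := by exact_mod_cast blockBase_pos Q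
  have h1 := two_div_spikeDen_le hQ i
  have h2 : 2 / (blockBase Q : ℝ) ^ 2 = 1 / (blockBase Q : ℝ) ^ 2 + 1 / (blockBase Q : ℝ) ^ 2 := by
    ring
  have h3 : x + 1 / (blockBase Q : ℝ) ^ 2 ≤ (spikePos Q i : ℝ) / spikeDen Q i ∨
      ((spikePos Q i : ℝ) + 1) / spikeDen Q i + 1 / (blockBase Q : ℝ) ^ 2 ≤ x := by
    rcases lt_abs.1 hx with h | h
    · right
      have := (abs_le.1 (abs_sub_node_le hQ0 (Set.right_mem_Icc.2 (spike_endpoints_le Q i)))).2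
      linarith
    · left
      have := lt_spikePos hQ0 i
      linarith
  have h4 := abs_integral_dirichlet_sub_le (m := m) (by positivity)
    (div_le_one_of_le₀ (one_le_pow₀ hb) (by positivity)) (spike_endpoints_le Q i) (by positivity)
    (spikePos_add_one_le hQ hi) hx0 hx1 h3
  rw [spikeMean, abs_mul, Nat.abs_cast]
  refine (mul_le_mul_of_nonneg_left h4 hH.le).trans ?_
  have hF' : (40 * (blockBase Q : ℝ) ^ 4 * spikeDen Q i) ≤ F := by exact_mod_cast hF
  have hF0 : (0 : ℝ) < F := lt_of_lt_of_le (by positivity) hF'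
  rw [hm, show (spikeDen Q i : ℝ) * (20 / (F / 2 * (1 / (blockBase Q : ℝ) ^ 2) ^ 2)) =
    40 * (blockBase Q : ℝ) ^ 4 * spikeDen Q i / F by field_simp; norm_num]
  exact div_le_one_of_le₀ hF' hF0.le

theorem abs_spikeMean_sub_dirichlet_le {Q i j : ℕ} (hQ : 0 < Q) (h : j < i) (x : ℝ) :
    |spikeMean Q i (order Q j) x - dirichlet (order Q j) (x - node Q i)| ≤ 1 := by
  have hH : (0 : ℝ) < spikeDen Q i := by exact_mod_cast spikeDen_pos hQ i
  refine abs_spikeMean_sub_le hQ fun t ht => (abs_dirichlet_sub_le _ _ _).trans ?_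
  rw [sub_sub_sub_cancel_left, abs_sub_comm]
  refine (mul_le_mul_of_nonneg_left (abs_sub_node_le hQ ht) (by positivity)).trans ?_
  rw [← mul_div_assoc]
  refine div_le_one_of_le₀ ?_ hH.le
  have h1 : 2 * order Q j ≤ freq Q j := Nat.mul_div_le _ _
  have h2 : order Q j ^ 2 * 2 ≤ freq Q j ^ 2 := by nlinarith
  exact_mod_cast h2.trans (freq_sq_le hQ h)

/-- The denominator b of the node divides `freq Q j`, so the shift by the node changes the phase by
a multiple of 2π and the numerator does not depend on i. -/
theorem dirichlet_sub_node {Q i j : ℕ} (hQ : Odd Q) {x : ℝ}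
    (h : Real.sin ((node Q i - x) / 2) ≠ 0) :
    dirichlet (order Q j) (x - node Q i) =
      -(Real.sin (freq Q j / 2 * x) * (2 * Real.sin ((node Q i - x) / 2))⁻¹) := by
  have hb : (0 : ℝ) < blockBase Q := by exact_mod_cast blockBase_pos Q
  rw [← dirichlet_neg, neg_sub, dirichlet_eq_div h, order_add_half hQ]
  have h1 : (freq Q j : ℝ) / 2 * (node Q i - x) =
      -(freq Q j / 2 * x - (blockScale Q ^ (12 * 3 ^ j + 5) * i : ℕ) * (2 * Real.pi)) := by
    rw [freq, node]
    push_cast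
    field_simp
    ring
  rw [h1, Real.sin_neg, Real.sin_sub_nat_mul_two_pi, neg_mul]

theorem node_lt_two_pi {Q i : ℕ} (hi : i ≤ blockSize Q) : node Q i < 2 * Real.pi := by
  have hb : (0 : ℝ) < blockBase Q := by exact_mod_cast blockBase_pos Q
  rw [node, div_lt_iff₀ hb, blockBase]
  have : (i : ℝ) ≤ blockSize Q := by exact_mod_cast hi
  push_cast
  nlinarith [Real.pi_pos]

theorem node_mono {Q i j : ℕ} (h : i ≤ j) : node Q i ≤ node Q j := by
  unfold node
  have := Real.pi_pos
  gcongr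

theorem sin_half_node_sub_pos {Q i j : ℕ} {x : ℝ} (hx0 : 0 < x) (hx : x < node Q (j + 1))
    (hi : j < i) (hin : i ≤ blockSize Q) : 0 < Real.sin ((node Q i - x) / 2) := by
  have h1 := node_mono (Q := Q) (Nat.succ_le_of_lt hi)
  have h2 := node_lt_two_pi hin
  exact Real.sin_pos_of_pos_of_lt_pi (by simp only [Nat.succ_eq_add_one] at h1; linarith)
    (by linarith)

/-- By sin u ≤ u, the denominators are at most the distance from node j, which is 4π/b times 1, 2,
3, …; the reciprocals add up to a harmonic number. -/
theorem le_sum_inv_sin {Q j : ℕ} {x : ℝ} (hx0 : 0 < x) (hj : j ≤ blockSize Q) (hxj : node Q j ≤ x)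
    (hx : x < node Q (j + 1)) :
    (blockBase Q : ℝ) / (4 * Real.pi) * harmonic (blockSize Q - j) ≤
      ∑ i ∈ Finset.range (blockSize Q + 1),
        if i ≤ j then 0 else (2 * Real.sin ((node Q i - x) / 2))⁻¹ := by
  have hb : (0 : ℝ) < blockBase Q := by exact_mod_cast blockBase_pos Q
  have hpi := Real.pi_pos
  have hn : blockSize Q + 1 = (j + 1) + (blockSize Q - j) := by omega
  rw [hn, Finset.sum_range_add, Finset.sum_eq_zero, zero_add, harmonic, Rat.cast_sum,
    Finset.mul_sum]
  · refine Finset.sum_le_sum fun i hi => ?_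
    rw [Finset.mem_range] at hi
    rw [if_neg (by omega)]
    have hs := sin_half_node_sub_pos (i := j + 1 + i) hx0 hx (by omega) (by omega)
    have h1 := node_mono (Q := Q) (show j + 1 ≤ j + 1 + i by omega)
    have h2 : 2 * Real.sin ((node Q (j + 1 + i) - x) / 2) ≤ 4 * Real.pi / blockBase Q * (i + 1) := by
      have h3 := (Real.sin_lt (x := (node Q (j + 1 + i) - x) / 2) (by linarith)).le
      have h4 : node Q (j + 1 + i) - node Q j = 4 * Real.pi / blockBase Q * (i + 1) := by
        unfold node
        push_cast
        ring
      linarith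
    calc (blockBase Q : ℝ) / (4 * Real.pi) * (((i + 1 : ℕ) : ℚ)⁻¹ : ℚ)
        = (4 * Real.pi / blockBase Q * (i + 1))⁻¹ := by
          push_cast
          rw [mul_inv, inv_div]
      _ ≤ _ := inv_anti₀ (by positivity) h2
  · intro i hi
    rw [Finset.mem_range] at hi
    exact if_pos (by omega)

/-! ### Lower bound for one block at a regular point -/

/-- The points outside the exceptional set of the block with parameter `Q`. -/
structure IsRegularPoint (Q : ℕ) (x : ℝ) : Prop where
  le_self : 1 / (blockBase Q : ℝ) ^ 2 ≤ x
  self_le : x ≤ 2 * Real.pi - 1 / (blockBase Q : ℝ) ^ 2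
  lt_abs_sub : ∀ i ≤ blockSize Q, 2 / (blockBase Q : ℝ) ^ 2 < |x - node Q i|
  le_abs_sin : ∀ j ≤ blockSize Q, node Q j ≤ x → x ≤ node Q (j + 1) →
    1 / (Q : ℝ) ≤ |Real.sin (freq Q j / 2 * x)|

theorem exists_node_le_lt (Q : ℕ) {x : ℝ} (hx0 : 0 ≤ x) (hx1 : x < 2 * Real.pi) :
    ∃ j ≤ blockSize Q, node Q j ≤ x ∧ x < node Q (j + 1) := by
  have hb : (0 : ℝ) < blockBase Q := by exact_mod_cast blockBase_pos Q
  have hpi := Real.pi_pos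
  refine ⟨⌊x * blockBase Q / (4 * Real.pi)⌋₊, ?_, ?_, ?_⟩
  · refine Nat.lt_succ_iff.1 ((Nat.floor_lt (by positivity)).2 ?_)
    rw [div_lt_iff₀ (by positivity)]
    have h1 : x * blockBase Q < 2 * Real.pi * blockBase Q := by gcongr
    have h2 : (blockBase Q : ℝ) = 2 * blockSize Q + 1 := by rw [blockBase]; push_cast; ring
    rw [h2] at h1 ⊢
    push_cast
    nlinarith
  · have := Nat.floor_le (show 0 ≤ x * blockBase Q / (4 * Real.pi) by positivity)
    rw [le_div_iff₀ (by positivity)] at this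
    rw [node, div_le_iff₀ hb]
    linarith
  · have := Nat.lt_floor_add_one (x * blockBase Q / (4 * Real.pi))
    rw [div_lt_iff₀ (by positivity)] at this
    rw [node, lt_div_iff₀ hb]
    push_cast
    linarith

/-- A proportion at least 2^(-k) of the period lies to the right of x, so n - j + 1 ≥ n·2^(-k),
whose logarithm is (Q^3 - k) log 2; and log 2 > 1/2. -/
theorem le_harmonic {Q k j : ℕ} {x : ℝ} (hk : (k : ℝ) ≤ (Q : ℝ) ^ 3)
    (hx : (1 / 2 : ℝ) ^ k ≤ 1 - x / (2 * Real.pi))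
    (hx1 : x ≤ 2 * Real.pi) (hj : j ≤ blockSize Q) (hjx : node Q j ≤ x) :
    ((Q : ℝ) ^ 3 - k) / 2 ≤ (harmonic (blockSize Q - j) : ℝ) := by
  have hb : (0 : ℝ) < blockBase Q := by exact_mod_cast blockBase_pos Q
  have hpi := Real.pi_pos
  have hn : (0 : ℝ) < blockSize Q := by exact_mod_cast blockSize_pos Q
  have h1 : (blockSize Q : ℝ) * (1 / 2) ^ k ≤ ((blockSize Q - j + 1 : ℕ) : ℝ) := by
    refine (mul_le_mul_of_nonneg_left hx hn.le).trans ?_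
    rw [Nat.cast_add, Nat.cast_sub hj, Nat.cast_one]
    have h2 : (j : ℝ) ≤ x / (2 * Real.pi) * (blockSize Q + 1 / 2) := by
      rw [node, div_le_iff₀ hb] at hjx
      have h3 : (blockBase Q : ℝ) = 2 * blockSize Q + 1 := by rw [blockBase]; push_cast; ring
      rw [h3] at hjx
      rw [div_mul_eq_mul_div, le_div_iff₀ (by positivity)]
      linarith
    have h4 : x / (2 * Real.pi) ≤ 1 := by
      rw [div_le_one (by positivity)]
      exact hx1
    linarith
  refine le_trans ?_ (log_add_one_le_harmonic _)
  refine le_trans ?_ (Real.log_le_log (by positivity) h1)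
  rw [Real.log_mul hn.ne' (by positivity), Real.log_pow, one_div, Real.log_inv, blockSize]
  push_cast
  rw [Real.log_pow]
  have hlog := Real.log_two_gt_d9
  push_cast
  nlinarith

theorem le_abs_sum_spikeMean {Q j : ℕ} (hQ : 41 ≤ Q) (hodd : Odd Q) {x : ℝ}
    (h : IsRegularPoint Q x) (hj : j ≤ blockSize Q) (hjx : node Q j ≤ x)
    (hxj : x < node Q (j + 1)) :
    1 / (Q : ℝ) * ((blockBase Q : ℝ) / (4 * Real.pi) * harmonic (blockSize Q - j)) -
        (blockSize Q + 1 : ℕ) ≤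
      |∑ i ∈ Finset.range (blockSize Q + 1), spikeMean Q i (order Q j) x| := by
  have hx0 : 0 < x := by
    have hb : (0 : ℝ) < blockBase Q := by exact_mod_cast blockBase_pos Q
    exact lt_of_lt_of_le (by positivity) h.le_self
  set s := Real.sin (freq Q j / 2 * x)
  set w : ℕ → ℝ := fun i => if i ≤ j then 0 else (2 * Real.sin ((node Q i - x) / 2))⁻¹
  -- Every spike deviates by at most 1 from its model value: zero for the wide spikes i ≤ j, the
  -- kernel at the node for the narrow ones.
  have h1 : ∀ i ∈ Finset.range (blockSize Q + 1),
      |spikeMean Q i (order Q j) x - -(s * w i)| ≤ 1 := by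
    intro i hi
    have hi' := Nat.lt_succ_iff.1 (Finset.mem_range.1 hi)
    by_cases hij : i ≤ j
    · simp only [w, if_pos hij, mul_zero, neg_zero, sub_zero]
      exact abs_spikeMean_le_one hQ hi' (order_add_half hodd j) (mul_spikeDen_le_freq hQ hij)
        h.le_self h.self_le (h.lt_abs_sub i hi')
    · simp only [w, if_neg hij]
      rw [← dirichlet_sub_node hodd
        (sin_half_node_sub_pos hx0 hxj (not_le.1 hij) hi').ne']
      exact abs_spikeMean_sub_dirichlet_le (by omega) (not_le.1 hij) x
  have h2 : |∑ i ∈ Finset.range (blockSize Q + 1), spikeMean Q i (order Q j) x -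
      -(s * ∑ i ∈ Finset.range (blockSize Q + 1), w i)| ≤ (blockSize Q + 1 : ℕ) := by
    rw [Finset.mul_sum, ← Finset.sum_neg_distrib, ← Finset.sum_sub_distrib]
    refine (Finset.abs_sum_le_sum_abs _ _).trans ((Finset.sum_le_sum h1).trans ?_)
    simp
  have h3 := le_sum_inv_sin hx0 hj hjx hxj
  have h4 := h.le_abs_sin j hj hjx hxj.le
  have h5 : 0 ≤ (blockBase Q : ℝ) / (4 * Real.pi) * harmonic (blockSize Q - j) := by
    have : (0 : ℚ) ≤ harmonic (blockSize Q - j) :=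
      Finset.sum_nonneg fun i _ => by positivity
    have h6 : (0 : ℝ) ≤ harmonic (blockSize Q - j) := by exact_mod_cast this
    have := Real.pi_pos
    positivity
  have h7 : 1 / (Q : ℝ) * ((blockBase Q : ℝ) / (4 * Real.pi) * harmonic (blockSize Q - j)) ≤
      |-(s * ∑ i ∈ Finset.range (blockSize Q + 1), w i)| := by
    rw [abs_neg, abs_mul]
    exact mul_le_mul h4 (h3.trans (le_abs_self _)) h5 (abs_nonneg _)
  have h8 := abs_sub_abs_le_abs_sub (-(s * ∑ i ∈ Finset.range (blockSize Q + 1), w i))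
    (∑ i ∈ Finset.range (blockSize Q + 1), spikeMean Q i (order Q j) x)
  rw [abs_sub_comm] at h8
  linarith

/-- The contribution of the `k`-th block to a partial sum. -/
noncomputable def blockPart (k m : ℕ) (x : ℝ) : ℝ :=
  1 / (blockScale (param k) : ℝ) *
      ∑ i ∈ Finset.range (blockSize (param k) + 1), spikeMean (param k) i m x

theorem abs_blockPart_le {k m : ℕ} {x C : ℝ}
    (h : ∀ i ≤ blockSize (param k), |spikeMean (param k) i m x| ≤ C) :
    |blockPart k m x| ≤ C * (1 / param k) := by
  have hC : 0 ≤ C := (abs_nonneg _).trans (h 0 (Nat.zero_le _))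
  rw [blockPart, abs_mul, abs_of_nonneg (by positivity)]
  have h1 : |∑ i ∈ Finset.range (blockSize (param k) + 1), spikeMean (param k) i m x| ≤
      (blockSize (param k) + 1 : ℕ) * C := by
    refine (Finset.abs_sum_le_sum_abs _ _).trans ((Finset.sum_le_sum (g := fun _ => C)
      fun i hi => h i (Nat.lt_succ_iff.1 (Finset.mem_range.1 hi))).trans ?_)
    simp
  calc _ ≤ 1 / (blockScale (param k) : ℝ) * ((blockSize (param k) + 1 : ℕ) * C) := by gcongr
    _ = C * (((blockSize (param k) + 1 : ℕ) : ℝ) / blockScale (param k)) := by ring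
    _ ≤ _ := mul_le_mul_of_nonneg_left (blockSize_add_one_div_le (param_pos k)) hC

theorem exists_forall_abs_blockPart_le (k : ℕ) {x : ℝ}
    (hx : Irrational x) (hx0 : 0 < x) (hx1 : x < 2 * Real.pi) :
    ∃ C, ∀ m, |blockPart k m x| ≤ C := by
  have h (i : ℕ) : ∃ C, i ≤ blockSize (param k) → ∀ m, |spikeMean (param k) i m x| ≤ C := by
    by_cases hi : i ≤ blockSize (param k)
    · obtain ⟨C, hC⟩ := exists_forall_abs_spikeMean_le (le_param k) hi hx hx0 hx1
      exact ⟨C, fun _ => hC⟩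
    · exact ⟨0, fun h => absurd h hi⟩
  choose C hC using h
  refine ⟨_, fun m => abs_blockPart_le (C := ∑ i ∈ Finset.range (blockSize (param k) + 1), |C i|)
    fun i hi => (hC i hi m).trans ((le_abs_self _).trans ?_)⟩
  exact Finset.single_le_sum (f := fun i => |C i|) (fun _ _ => abs_nonneg _)
    (Finset.mem_range.2 (Nat.lt_succ_iff.2 hi))

theorem le_abs_blockPart {k : ℕ} {x : ℝ} (h : IsRegularPoint (param k) x)
    (hx : (1 / 2 : ℝ) ^ k ≤ 1 - x / (2 * Real.pi)) :
    ∃ j ≤ blockSize (param k),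
      ((param k : ℝ) - 1) / 32 - 1 ≤ |blockPart k (order (param k) j) x| := by
  have hb : (0 : ℝ) < blockBase (param k) := by exact_mod_cast blockBase_pos _
  have hQ : (0 : ℝ) < param k := by exact_mod_cast param_pos k
  have hpi := Real.pi_pos
  have hd : 0 < 1 / (blockBase (param k) : ℝ) ^ 2 := by positivity
  have hx0 := h.le_self
  have hx1 := h.self_le
  obtain ⟨j, hj, hjx, hxj⟩ := exists_node_le_lt (param k) (x := x) (by linarith) (by linarith)
  refine ⟨j, hj, ?_⟩
  have h1 := le_abs_sum_spikeMean (le_param k) (odd_param k) h hj hjx hxj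
  have hk : (k : ℝ) ≤ param k := by
    exact_mod_cast Nat.lt_two_pow_self.le.trans (two_pow_le_param k)
  have hQ1 : (1 : ℝ) ≤ param k := by exact_mod_cast param_pos k
  have h2 := le_harmonic (hk.trans (le_self_pow₀ hQ1 (by norm_num))) hx (by linarith) hj hjx
  have hβ : (blockScale (param k) : ℝ) = param k * blockBase (param k) := by
    rw [blockScale]; push_cast; ring
  have hβ0 : (0 : ℝ) < blockScale (param k) := by rw [hβ]; positivity
  rw [blockPart, abs_mul, abs_of_nonneg (by positivity)]
  refine le_trans ?_ (mul_le_mul_of_nonneg_left h1 (by positivity))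
  have h3 := blockSize_add_one_div_le (param_pos k)
  have h4 : (1 : ℝ) / param k ≤ 1 := by
    rw [div_le_one hQ]
    exact_mod_cast param_pos k
  have h5 : ((param k : ℝ) - 1) / 32 ≤
      1 / (4 * Real.pi * param k ^ 2) * harmonic (blockSize (param k) - j) := by
    refine le_trans ?_ (mul_le_mul_of_nonneg_left h2 (by positivity))
    -- The loss k from the position of x is at most Q^2, which is negligible against Q^3.
    have h6 : ((param k : ℝ) - 1) * param k ^ 2 ≤ (param k : ℝ) ^ 3 - k := by nlinarith
    calc ((param k : ℝ) - 1) / 32 ≤ (param k - 1) / (8 * Real.pi) := by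
          have := Real.pi_lt_four
          have h0 : (0 : ℝ) ≤ param k - 1 := by linarith
          gcongr
          linarith
      _ = 1 / (4 * Real.pi * param k ^ 2) * ((param k - 1) * param k ^ 2 / 2) := by
          field_simp; ring
      _ ≤ _ := by gcongr
  have h7 : 1 / (blockScale (param k) : ℝ) * (1 / (param k : ℝ) * ((blockBase (param k) : ℝ) /
      (4 * Real.pi) * harmonic (blockSize (param k) - j)) - (blockSize (param k) + 1 : ℕ)) =
      1 / (4 * Real.pi * param k ^ 2) * harmonic (blockSize (param k) - j) -
        ((blockSize (param k) + 1 : ℕ) : ℝ) / blockScale (param k) := by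
    rw [hβ]
    field_simp
  rw [h7]
  linarith

/-- The crude bound m + 1/2 = `freq`/2 is multiplied by the remaining mass, at most 2/`param (k +
1)`, and that parameter dominates every frequency of block k. -/
theorem abs_tsum_blockPart_le {k j : ℕ} (hj : j ≤ blockSize (param k)) (x : ℝ) :
    |∑' l, blockPart (l + (k + 1)) (order (param k) j) x| ≤ 1 := by
  have hs : Summable fun l => ((order (param k) j : ℝ) + 1 / 2) * (1 / (param (l + (k + 1)) : ℝ)) :=
    ((summable_nat_add_iff (k + 1)).2 summable_inv_param).mul_left _
  have h := tsum_of_norm_bounded (f := fun l => blockPart (l + (k + 1)) (order (param k) j) x)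
    hs.hasSum fun l =>
      abs_blockPart_le fun i _ => abs_spikeMean_le (param_pos (l + (k + 1))) i _ x
  rw [Real.norm_eq_abs, tsum_mul_left] at h
  refine h.trans ?_
  rw [order_add_half (odd_param k)]
  have hQ : (0 : ℝ) < param (k + 1) := by exact_mod_cast param_pos _
  calc _ ≤ (freq (param k) j / 2 : ℝ) * (2 / param (k + 1)) := by
        gcongr
        exact tsum_inv_param_le (k + 1)
    _ = freq (param k) j / param (k + 1) := by ring
    _ ≤ 1 := div_le_one_of_le₀ (by exact_mod_cast freq_le_param hj) hQ.le

/-! ### Divergence at points that are eventually regular -/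

theorem fourierSeriesDivergesAt_blockSum {x : ℝ} (hx : Irrational x) (hx0 : 0 < x)
    (hx1 : x < 2 * Real.pi) (h : ∀ᶠ k in atTop, IsRegularPoint (param k) x) :
    FourierSeriesDivergesAt blockSum x := by
  rintro ⟨y, hy⟩
  have hpi := Real.pi_pos
  obtain ⟨B, hB⟩ := (Metric.isBounded_range_of_tendsto _ hy).exists_norm_le
  have hB' (m : ℕ) : |fourierPartialSum blockSum m x| ≤ B := hB _ ⟨m, rfl⟩
  have hk : ∀ᶠ k : ℕ in atTop, (1 / 2 : ℝ) ^ k < 1 - x / (2 * Real.pi) := by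
    refine (tendsto_pow_atTop_nhds_zero_of_lt_one (by norm_num) (by norm_num)).eventually_lt_const ?_
    rw [sub_pos, div_lt_one (by positivity)]
    exact hx1
  obtain ⟨k₀, hk₀⟩ := eventually_atTop.1 (h.and hk)
  choose C hC using fun k => exists_forall_abs_blockPart_le k hx hx0 hx1
  have hC0 (k : ℕ) : 0 ≤ C k := (abs_nonneg _).trans (hC k 0)
  -- If the partial sums were bounded by B, isolating block k would bound `param k` uniformly. The 3
  -- collects 1 from the later blocks, 1 from the regular earlier blocks, and the loss 1 in
  -- `le_abs_blockPart`.
  have key (k : ℕ) (hk : k₀ ≤ k) :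
      ((param k : ℝ) - 1) / 32 ≤ Real.pi * B + ∑ l ∈ Finset.range k₀, C l + 3 := by
    obtain ⟨hreg, hxk⟩ := hk₀ k hk
    obtain ⟨j, hj, hbig⟩ := le_abs_blockPart hreg hxk.le
    have hsum : HasSum (fun l => blockPart l (order (param k) j) x)
      (Real.pi * fourierPartialSum blockSum (order (param k) j) x) := hasSum_fourierPartialSum _ x
    have h1 := hsum.summable.sum_add_tsum_nat_add (k + 1)
    rw [hsum.tsum_eq, Finset.sum_range_succ] at h1
    have h2 := abs_tsum_blockPart_le hj x
    have h3 : |∑ l ∈ Finset.range k, blockPart l (order (param k) j) x| ≤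
        ∑ l ∈ Finset.range k₀, C l + 1 := by
      have h4 : ∀ l ∈ Finset.range k, |blockPart l (order (param k) j) x| ≤
          (if l < k₀ then C l else 0) + 1 / param l := by
        intro l hl
        split_ifs with hlk
        · have := hC l (order (param k) j)
          have h0 : (0 : ℝ) ≤ 1 / param l := by positivity
          linarith
        · have hreg' := (hk₀ l (not_lt.1 hlk)).1
          have := abs_blockPart_le (C := 1) fun i hi => abs_spikeMean_le_one (le_param l) hi
            (order_add_half (odd_param k) j)
            (mul_spikeDen_le_freq_of_lt (Finset.mem_range.1 hl) hi j) hreg'.le_self hreg'.self_le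
            (hreg'.lt_abs_sub i hi)
          linarith
      have h5 : ∑ l ∈ Finset.range k, (if l < k₀ then C l else 0) = ∑ l ∈ Finset.range k₀, C l := by
        rw [← Finset.sum_filter]
        congr 1
        ext l
        simp only [Finset.mem_filter, Finset.mem_range]
        omega
      have h6 : ∑ l ∈ Finset.range k, 1 / (param l : ℝ) ≤ 1 := by
        refine (summable_inv_param.sum_le_tsum _ fun _ _ => by positivity).trans
          ((tsum_inv_param_le 0).trans ?_)
        have : (41 : ℝ) ≤ param 0 := by exact_mod_cast le_param 0
        rw [div_le_one (by linarith)]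
        linarith
      refine (Finset.abs_sum_le_sum_abs _ _).trans ((Finset.sum_le_sum h4).trans ?_)
      rw [Finset.sum_add_distrib, h5]
      linarith
    have h7 : |Real.pi * fourierPartialSum blockSum (order (param k) j) x| ≤ Real.pi * B := by
      rw [abs_mul, abs_of_pos hpi]
      exact mul_le_mul_of_nonneg_left (hB' _) hpi.le
    rw [← h1] at h7
    have h8 := abs_sub_abs_le_abs_sub (blockPart k (order (param k) j) x)
      (-(∑ l ∈ Finset.range k, blockPart l (order (param k) j) x +
        ∑' l, blockPart (l + (k + 1)) (order (param k) j) x))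
    rw [abs_neg, sub_neg_eq_add] at h8
    have h9 := abs_add_le (∑ l ∈ Finset.range k, blockPart l (order (param k) j) x)
      (∑' l, blockPart (l + (k + 1)) (order (param k) j) x)
    have h10 : blockPart k (order (param k) j) x +
      (∑ l ∈ Finset.range k, blockPart l (order (param k) j) x +
        ∑' l, blockPart (l + (k + 1)) (order (param k) j) x) =
      ∑ l ∈ Finset.range k, blockPart l (order (param k) j) x + blockPart k (order (param k) j) x +
        ∑' l, blockPart (l + (k + 1)) (order (param k) j) x := by ring
    rw [h10] at h8
    linarith
  obtain ⟨N, hN⟩ := exists_nat_gt (32 * (Real.pi * B + ∑ l ∈ Finset.range k₀, C l + 3) + 1)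
  have h1 := key (max k₀ N) (le_max_left _ _)
  have h2 : (N : ℝ) ≤ param (max k₀ N) := by
    exact_mod_cast (le_max_right k₀ N).trans (Nat.lt_two_pow_self.le.trans (two_pow_le_param _))
  linarith

/-! ### Measure of the exceptional sets -/

/-- A neighbourhood of the spikes of a block. -/
def nearNodes (Q : ℕ) : Set ℝ :=
  ⋃ i ∈ Finset.range (blockSize Q + 1), Metric.closedBall (node Q i) (2 / (blockBase Q : ℝ) ^ 2)

/-- A neighbourhood of the zeros of `sin (freq Q j * x / 2)` between the nodes `j` and `j + 1`. -/
def nearZeros (Q : ℕ) : Set ℝ :=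
  ⋃ j ∈ Finset.range (blockSize Q + 1),
    ⋃ q ∈ Finset.Icc (2 * j * blockScale Q ^ (12 * 3 ^ j + 5))
      (2 * (j + 1) * blockScale Q ^ (12 * 3 ^ j + 5)),
    Metric.closedBall (2 * Real.pi * (q : ℕ) / freq Q j) (Real.pi / (Q * freq Q j))

theorem blockSize_add_one_le (Q : ℕ) : blockSize Q + 1 ≤ blockBase Q := by
  have := blockSize_pos Q
  unfold blockBase
  omega

theorem volume_nearNodes_le {Q : ℕ} (hQ : 0 < Q) :
    volume (nearNodes Q) ≤ ENNReal.ofReal (4 / Q) := by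
  have hb : (0 : ℝ) < blockBase Q := by exact_mod_cast blockBase_pos Q
  have hQ' : (0 : ℝ) < Q := by exact_mod_cast hQ
  have hQb : (Q : ℝ) ≤ blockBase Q := by
    exact_mod_cast (show Q ≤ blockBase Q by have := two_mul_lt_blockBase Q; omega)
  refine (measure_biUnion_finset_le _ _).trans ?_
  simp only [Real.volume_closedBall]
  rw [Finset.sum_const, Finset.card_range, nsmul_eq_mul, ← ENNReal.ofReal_natCast,
    ← ENNReal.ofReal_mul (by positivity)]
  refine ENNReal.ofReal_le_ofReal ?_
  calc ((blockSize Q + 1 : ℕ) : ℝ) * (2 * (2 / (blockBase Q : ℝ) ^ 2))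
      ≤ blockBase Q * (2 * (2 / (blockBase Q : ℝ) ^ 2)) := by
        gcongr
        exact blockSize_add_one_le Q
    _ = 4 / (blockBase Q : ℝ) := by field_simp; ring
    _ ≤ 4 / (Q : ℝ) := by gcongr

theorem volume_nearZeros_le {Q : ℕ} (hQ : 0 < Q) :
    volume (nearZeros Q) ≤ ENNReal.ofReal (24 / Q) := by
  have hb : (0 : ℝ) < blockBase Q := by exact_mod_cast blockBase_pos Q
  have hQ' : (0 : ℝ) < Q := by exact_mod_cast hQ
  have hpi := Real.pi_pos
  have key (j : ℕ) : volume (⋃ q ∈ Finset.Icc (2 * j * blockScale Q ^ (12 * 3 ^ j + 5))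
      (2 * (j + 1) * blockScale Q ^ (12 * 3 ^ j + 5)),
      Metric.closedBall (2 * Real.pi * (q : ℕ) / freq Q j) (Real.pi / (Q * freq Q j))) ≤
      ENNReal.ofReal (24 / (Q * blockBase Q)) := by
    have hfreq : (freq Q j : ℝ) = blockBase Q * (blockScale Q ^ (12 * 3 ^ j + 5) : ℕ) := by
      rw [freq, Nat.cast_mul]
    have hp0 : 0 < blockScale Q ^ (12 * 3 ^ j + 5) := Nat.pow_pos (blockScale_pos hQ)
    rw [hfreq]
    generalize blockScale Q ^ (12 * 3 ^ j + 5) = p at hp0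
    have hp : (1 : ℝ) ≤ p := by exact_mod_cast hp0
    refine (measure_biUnion_finset_le _ _).trans ?_
    simp only [Real.volume_closedBall]
    -- Between consecutive nodes, both included, the sine has 2p + 1 zeros, where `freq Q j` = bp.
    have hcard : 2 * (j + 1) * p + 1 - 2 * j * p = 2 * p + 1 := by
      rw [show 2 * (j + 1) * p + 1 = 2 * p + 1 + 2 * j * p by ring, Nat.add_sub_cancel]
    rw [Finset.sum_const, Nat.card_Icc, hcard, nsmul_eq_mul, ← ENNReal.ofReal_natCast,
      ← ENNReal.ofReal_mul (by positivity)]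
    refine ENNReal.ofReal_le_ofReal ?_
    calc ((2 * p + 1 : ℕ) : ℝ) * (2 * (Real.pi / (Q * (blockBase Q * p))))
        ≤ (3 * p) * (2 * (4 / (Q * (blockBase Q * p)))) := by
          push_cast
          have := Real.pi_lt_four
          gcongr
          linarith
      _ = 24 / (Q * blockBase Q) := by field_simp; norm_num
  refine (measure_biUnion_finset_le _ _).trans ((Finset.sum_le_sum fun j _ => key j).trans ?_)
  rw [Finset.sum_const, Finset.card_range, nsmul_eq_mul, ← ENNReal.ofReal_natCast,
    ← ENNReal.ofReal_mul (by positivity)]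
  refine ENNReal.ofReal_le_ofReal ?_
  calc ((blockSize Q + 1 : ℕ) : ℝ) * (24 / (Q * blockBase Q))
      ≤ blockBase Q * (24 / (Q * blockBase Q)) := by
        gcongr
        exact blockSize_add_one_le Q
    _ = 24 / Q := by field_simp

theorem isRegularPoint_of_notMem {Q : ℕ} (hQ : 0 < Q) {x : ℝ}
    (h1 : 1 / (blockBase Q : ℝ) ^ 2 ≤ x) (h2 : x ≤ 2 * Real.pi - 1 / (blockBase Q : ℝ) ^ 2)
    (h3 : x ∉ nearNodes Q) (h4 : x ∉ nearZeros Q) : IsRegularPoint Q x := by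
  refine ⟨h1, h2, fun i hi => ?_, fun j hj hjx hxj => ?_⟩
  · by_contra hcon
    refine h3 (Set.mem_biUnion (Finset.mem_coe.2 (Finset.mem_range.2 (Nat.lt_succ_iff.2 hi))) ?_)
    rw [Metric.mem_closedBall, Real.dist_eq]
    exact not_lt.1 hcon
  · have hb : (0 : ℝ) < blockBase Q := by exact_mod_cast blockBase_pos Q
    have hQ' : (0 : ℝ) < Q := by exact_mod_cast hQ
    have hpi := Real.pi_pos
    have hF : (0 : ℝ) < freq Q j := by exact_mod_cast freq_pos hQ j
    have hx0 : 0 ≤ x := le_trans (by positivity) h1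
    set y : ℝ := freq Q j / 2 * x with hy
    have hnode (i : ℕ) : freq Q j / 2 * node Q i =
        ((2 * i * blockScale Q ^ (12 * 3 ^ j + 5) : ℕ) : ℝ) * Real.pi := by
      rw [freq, node]
      push_cast
      field_simp
      ring
    have hy1 : ((2 * j * blockScale Q ^ (12 * 3 ^ j + 5) : ℕ) : ℝ) ≤ y / Real.pi := by
      rw [le_div_iff₀ hpi, ← hnode, hy]
      gcongr
    have hy2 : y / Real.pi ≤ ((2 * (j + 1) * blockScale Q ^ (12 * 3 ^ j + 5) : ℕ) : ℝ) := by
      rw [div_le_iff₀ hpi, ← hnode, hy]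
      gcongr
    have hy0 : 0 ≤ y / Real.pi := by positivity
    -- The nearest integer to y/π: then |y - qπ| ≤ π/2, where Jordan's inequality bounds the sine
    -- below. It stays in the indexed range because y/π lies between the integer values at the two
    -- nodes.
    set q := ⌊y / Real.pi + 1 / 2⌋₊
    have hq1 : (q : ℝ) ≤ y / Real.pi + 1 / 2 := Nat.floor_le (by positivity)
    have hq2 : y / Real.pi + 1 / 2 < q + 1 := Nat.lt_floor_add_one _
    have hq : q ∈ Finset.Icc (2 * j * blockScale Q ^ (12 * 3 ^ j + 5))
        (2 * (j + 1) * blockScale Q ^ (12 * 3 ^ j + 5)) := by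
      refine Finset.mem_Icc.2 ⟨Nat.le_floor (by linarith), Nat.lt_succ_iff.1 ?_⟩
      refine (Nat.floor_lt (by positivity)).2 ?_
      rw [Nat.cast_succ]
      linarith
    have hx : Real.pi / (Q * freq Q j) < |x - 2 * Real.pi * q / freq Q j| := by
      by_contra hcon
      refine h4 (Set.mem_biUnion (Finset.mem_coe.2 (Finset.mem_range.2 (Nat.lt_succ_iff.2 hj)))
        (Set.mem_biUnion (Finset.mem_coe.2 hq) ?_))
      rw [Metric.mem_closedBall, Real.dist_eq]
      exact not_lt.1 hcon
    have h5 : y - q * Real.pi = freq Q j / 2 * (x - 2 * Real.pi * q / freq Q j) := by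
      rw [hy]; field_simp
    have h6 : |y - q * Real.pi| ≤ Real.pi / 2 := by
      have : y - q * Real.pi = (y / Real.pi - q) * Real.pi := by field_simp
      rw [this, abs_mul, abs_of_pos hpi, div_eq_mul_one_div Real.pi,
        mul_comm Real.pi]
      refine mul_le_mul_of_nonneg_right ?_ hpi.le
      exact abs_le.2 ⟨by linarith, by linarith⟩
    have h7 : |Real.sin y| = |Real.sin (y - q * Real.pi)| := by
      rw [Real.sin_sub_nat_mul_pi, abs_mul, abs_pow, abs_neg, abs_one, one_pow, one_mul]
    rw [h7]
    refine le_trans ?_ (Real.mul_abs_le_abs_sin h6)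
    rw [h5, abs_mul, abs_of_pos (by positivity)]
    calc 1 / (Q : ℝ) = 2 / Real.pi * (freq Q j / 2 * (Real.pi / (Q * freq Q j))) := by field_simp
      _ ≤ _ := by gcongr

/-! ### Borel–Cantelli and the conclusion -/

theorem ae_eventually_notMem_of_volume_le {s : ℕ → Set ℝ} {C : ℝ} (hC : 0 ≤ C)
    (h : ∀ k, volume (s k) ≤ ENNReal.ofReal (C / param k)) :
    ∀ᵐ x, ∀ᶠ k in atTop, x ∉ s k := by
  refine ae_eventually_notMem (ne_top_of_le_ne_top ?_ (ENNReal.tsum_le_tsum h))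
  have hs : Summable fun k => C / (param k : ℝ) := by
    simpa [div_eq_mul_inv] using summable_inv_param.mul_left C
  rw [← ENNReal.ofReal_tsum_of_nonneg (fun k => by positivity) hs]
  exact ENNReal.ofReal_ne_top

theorem eventually_one_div_blockBase_sq_le {ε : ℝ} (hε : 0 < ε) :
    ∀ᶠ k in atTop, 1 / (blockBase (param k) : ℝ) ^ 2 ≤ ε := by
  have h : ∀ᶠ k : ℕ in atTop, (1 / 2 : ℝ) ^ k < ε :=
    (tendsto_pow_atTop_nhds_zero_of_lt_one (by norm_num) (by norm_num)).eventually_lt_const hε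
  filter_upwards [h] with k hk
  refine le_trans ?_ hk.le
  rw [one_div_pow]
  refine one_div_le_one_div_of_le (by positivity) ?_
  have h1 : 2 ^ k ≤ blockBase (param k) := by
    have h1 := two_pow_le_param k
    have h2 := two_mul_lt_blockBase (param k)
    omega
  exact_mod_cast h1.trans (Nat.le_self_pow (by norm_num) _)

theorem ae_fourierSeriesDivergesAt_blockSum :
    ∀ᵐ x ∂circleMeasure, FourierSeriesDivergesAt blockSum x := by
  have h1 : ∀ᵐ x : ℝ, ∀ᶠ k in atTop, x ∉ nearNodes (param k) :=
    ae_eventually_notMem_of_volume_le (by norm_num) fun k => volume_nearNodes_le (param_pos k)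
  have h2 : ∀ᵐ x : ℝ, ∀ᶠ k in atTop, x ∉ nearZeros (param k) :=
    ae_eventually_notMem_of_volume_le (by norm_num) fun k => volume_nearZeros_le (param_pos k)
  have h3 : ∀ᵐ x : ℝ, Irrational x := by
    have := (Set.countable_range ((↑) : ℚ → ℝ)).ae_notMem volume
    exact this
  have h4 : ∀ᵐ x : ℝ, x ≠ 2 * Real.pi := by simp [ae_iff]
  rw [circleMeasure, ae_restrict_iff' measurableSet_Icc]
  filter_upwards [h1, h2, h3, h4] with x hx1 hx2 hx3 hx4 hx
  have hx0 : 0 < x := lt_of_le_of_ne hx.1 hx3.ne_zero.symm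
  have hxpi : x < 2 * Real.pi := lt_of_le_of_ne hx.2 hx4
  refine fourierSeriesDivergesAt_blockSum hx3 hx0 hxpi ?_
  -- The margins 1/b^2 at both ends of the period tend to 0, so they eventually exclude no given
  -- interior point.
  filter_upwards [hx1, hx2, eventually_one_div_blockBase_sq_le hx0,
    eventually_one_div_blockBase_sq_le (sub_pos.2 hxpi)] with k hk1 hk2 hk3 hk4
  exact isRegularPoint_of_notMem (param_pos k) hk3 (by linarith) hk1 hk2

end ComputableFourier

theorem mainTheorem6 :
    ∃ f : ℝ → ℝ, ComputableFourier.IsComputableLp 1 f ∧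
      ∀ᵐ x ∂ComputableFourier.circleMeasure, ComputableFourier.FourierSeriesDivergesAt f x :=
  ⟨ComputableFourier.blockSum, ComputableFourier.isComputableLp_blockSum,
    ComputableFourier.ae_fourierSeriesDivergesAt_blockSum⟩
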